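/- Consider $n$ qubits with Pauli operators $X_k,Y_k,Z_k$. The Pauli group $\mathcal P_n$ consists of the tensor products of $1,X,Y,Z$ with factors $\pm1,\pm i$. An operator acts only on a set $S$ of qubits if it is $B\otimes 1$ with $B$ an operator on the qubits in $S$. Given a function $d$ giving the distance between qubits, constants $R$ and $r$, a family $(A_k)_{k=1}^n$ is $(d,R,r)$-quasi-local if each $A_k$ acts only on a set of at most $r$ qubits within distance $R$ of qubit $k$. For rates $g_k>0$ and jump operators $c_1,\dots,c_n$ let $$\mathcal L_{\{c_k\}}(\rho)=\sum_k g_k\,(2c_k\rho c_k^\dagger-c_k^\dagger c_k\rho-\rho c_k^\dagger c_k).$$ A stationary state is a density operator $\rho$ with $\mathcal L_{\{c_k\}}(\rho)=0$. The relaxation time is $1/\min\{-\mathrm{Re}\,\mu\}$, the minimum being over the nonzero eigenvalues $\mu$ of $\mathcal L_{\{c_k\}}$. (1) Graph states. Let $G$ be a simple graph on the $n$ qubits, $N_k$ the set of neighbours of $k$, $U_k=X_kZ_{N_k}=X_k\prod_{b\in N_k}Z_b$ and $c_k=\tfrac12(1+U_k)Z_k$. There is, up to a phase, exactly one unit vector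 $|G\rangle$ with $U_k|G\rangle=|G\rangle$ for all $k$; it is the graph state. Both $U_k$ and $c_k$ act non-trivially exactly on the qubits $\{k\}\cup N_k$; in particular, if the $U_k$ are $(d,R,r)$-quasi-local, so are the $c_k$. The vectors $\Psi_i=Z_1^{i_1}\cdots Z_n^{i_n}|G\rangle$, $i\in\{0,1\}^n$, satisfy $U_k\Psi_i=(-1)^{i_k}\Psi_i$, the operator $U$ with $U|i\rangle=\Psi_i$ is unitary, and $c_k=U\sigma_-^{(k)}U^\dagger$ with $\sigma_-=|0\rangle\langle1|$. For all rates $g_k>0$ the projector $|G\rangle\langle G|$ is the unique stationary state of $\mathcal L_{\{c_k\}}$, no nonzero eigenvalue of $\mathcal L_{\{c_k\}}$ is purely imaginary, and, if $n\ge1$, the relaxation time is $1/\min_k g_k$, so that for a given minimal rate it does not depend on $n$ or $G$. (2) Stabilizer states. Let $|\psi\rangle$ be a stabilizer state, that is, a unit vector which is up to scalars the only vector fixed by all elements of $S(\psi)=\{A\in\mathcal P_n: A|\psi\rangle=|\psi\rangle\}$. Then there are a tensor product $V=V_1\otimes\dots\otimes V_n$ of one-qubit Clifford unitaries and a simple graph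 $G$ such that $|\psi\rangle=V|G\rangle$ for a graph state vector $|G\rangle$ of $G$. For every such $V$ and $G$, with $U_k$ and $c_k$ as in (1), the operators $VU_kV^\dagger$ lie in $S(\psi)$, and both $VU_kV^\dagger$ and $c(S)_k=Vc_kV^\dagger$ act non-trivially exactly on $\{k\}\cup N_k$; in particular, if the generators $U_k$ are $(d,R,r)$-quasi-local, so are the $c(S)_k$. For all rates $g_k>0$ the projector $|\psi\rangle\langle\psi|$ is the unique stationary state of $\mathcal L_{\{c(S)_k\}}$, no nonzero eigenvalue is purely imaginary, and, if $n\ge1$, the relaxation time is $1/\min_k g_k$. -/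

import Mathlib

open scoped Matrix ComplexOrder

noncomputable section

/-- The label set of the computational basis of `n` qubits. -/
abbrev Bits (n : ℕ) : Type := Fin n → Fin 2

/-- Vectors of the Hilbert space of `n` qubits. -/
abbrev QVec (n : ℕ) : Type := Bits n → ℂ

/-- Operators on the Hilbert space of `n` qubits, in the computational basis. -/
abbrev QOp (n : ℕ) : Type := Matrix (Bits n) (Bits n) ℂ

/-- The Pauli matrix `X`. -/
def pauliX : Matrix (Fin 2) (Fin 2) ℂ := !![0, 1; 1, 0]

/-- The Pauli matrix `Y`. -/
def pauliY : Matrix (Fin 2) (Fin 2) ℂ := !![0, -Complex.I; Complex.I, 0]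

/-- The Pauli matrix `Z`. -/
def pauliZ : Matrix (Fin 2) (Fin 2) ℂ := !![1, 0; 0, -1]

/-- The one-qubit lowering operator `|0⟩⟨1|`. -/
def sigmaMinus : Matrix (Fin 2) (Fin 2) ℂ := !![0, 1; 0, 0]

/-- The tensor product `A 0 ⊗ A 1 ⊗ ⋯ ⊗ A (n - 1)` of one-qubit operators. -/
def tensorOp {n : ℕ} (A : Fin n → Matrix (Fin 2) (Fin 2) ℂ) : QOp n :=
  Matrix.of fun x y => ∏ k, A k (x k) (y k)

/-- The one-qubit operator `A` on qubit `k`, the identity on all other qubits. -/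
def siteOp {n : ℕ} (k : Fin n) (A : Matrix (Fin 2) (Fin 2) ℂ) : QOp n :=
  tensorOp (Function.update (fun _ => 1) k A)

open Classical in
/-- `Z_S`, the product of the operators `Z_b` over the qubits `b ∈ S`. -/
def zOn {n : ℕ} (S : Set (Fin n)) : QOp n :=
  tensorOp fun j => if j ∈ S then pauliZ else 1

/-- The operator `A` acts only on the qubits in `S`: `A = B ⊗ 1`, with `B` an operator on the
qubits in `S` and the identity on the other qubits. -/
def ActsOnlyOn {n : ℕ} (A : QOp n) (S : Finset (Fin n)) : Prop :=
  ∃ B : Matrix (S → Fin 2) (S → Fin 2) ℂ, ∀ x y : Bits n,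
    ((∀ k, k ∉ S → x k = y k) → A x y = B (fun k => x k) (fun k => y k)) ∧
    ((∃ k, k ∉ S ∧ x k ≠ y k) → A x y = 0)

/-- Quasi-locality with explicit constants: each `A k` acts only on at most `r` qubits, all of them
within distance `R` of qubit `k`, where `d` is the distance between the sites of the qubits. -/
def IsQuasiLocal {n : ℕ} (d : Fin n → Fin n → ℝ) (R : ℝ) (r : ℕ) (A : Fin n → QOp n) : Prop :=
  ∀ k, ∃ S : Finset (Fin n), S.card ≤ r ∧ (∀ j ∈ S, d k j ≤ R) ∧ ActsOnlyOn (A k) S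

/-- The vector is normalized. -/
def IsUnitVec {n : ℕ} (ψ : QVec n) : Prop := star ψ ⬝ᵥ ψ = 1

/-- The operator `|ψ⟩⟨ψ|`. -/
def ketBra {n : ℕ} (ψ : QVec n) : QOp n := Matrix.vecMulVec ψ (star ψ)

/-- Density operators: positive semidefinite with trace one. -/
def IsDensity {n : ℕ} (ρ : QOp n) : Prop := ρ.PosSemidef ∧ ρ.trace = 1

/-- The Liouvillian of the purely dissipative process with jump operators `c k` and rates `g k`:
`ρ ↦ ∑ k, g k (2 c k ρ (c k)† - (c k)† c k ρ - ρ (c k)† c k)`. -/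
def liouvillian {n : ℕ} (g : Fin n → ℝ) (c : Fin n → QOp n) : Module.End ℂ (QOp n) where
  toFun ρ := ∑ k, (g k : ℂ) •
    ((2 : ℂ) • (c k * ρ * (c k)ᴴ) - (c k)ᴴ * c k * ρ - ρ * ((c k)ᴴ * c k))
  map_add' ρ τ := by
    rw [← Finset.sum_add_distrib]
    refine Finset.sum_congr rfl fun k _ => ?_
    rw [← smul_add]
    congr 1
    simp only [mul_add, add_mul, smul_add]
    abel
  map_smul' a ρ := by
    rw [RingHom.id_apply, Finset.smul_sum]
    refine Finset.sum_congr rfl fun k _ => ?_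
    rw [smul_comm a]
    congr 1
    simp only [mul_smul_comm, smul_mul_assoc, smul_sub]
    rw [smul_comm a]

/-- `|ψ⟩⟨ψ|` is the one and only density operator on which `L` vanishes. -/
def IsUniqueStationaryState {n : ℕ} (L : Module.End ℂ (QOp n)) (ψ : QVec n) : Prop :=
  IsDensity (ketBra ψ) ∧ ∀ ρ : QOp n, IsDensity ρ → (L ρ = 0 ↔ ρ = ketBra ψ)

/-- `T` is the relaxation time of `L`: the inverse of the minimum of `-Re μ` over the nonzero
eigenvalues `μ` of `L`. -/
def IsRelaxationTime {n : ℕ} (L : Module.End ℂ (QOp n)) (T : ℝ) : Prop :=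
  ∃ m : ℝ, 0 < m ∧ IsLeast {x : ℝ | ∃ μ : ℂ, L.HasEigenvalue μ ∧ μ ≠ 0 ∧ x = -μ.re} m ∧ T = 1 / m

/-- No eigenvalue of `L` is purely imaginary and nonzero. -/
def NoPurelyImaginaryEigenvalue {n : ℕ} (L : Module.End ℂ (QOp n)) : Prop :=
  ∀ μ : ℂ, L.HasEigenvalue μ → μ.re = 0 → μ = 0

/-- The generator `U_k = X_k Z_{N_k}` of the graph `G`. -/
def graphGen {n : ℕ} (G : SimpleGraph (Fin n)) (k : Fin n) : QOp n :=
  siteOp k pauliX * zOn (G.neighborSet k)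

/-- The jump operator `c_k = (1 + U_k) Z_k / 2`. -/
def graphJump {n : ℕ} (G : SimpleGraph (Fin n)) (k : Fin n) : QOp n :=
  (1 / 2 : ℂ) • ((1 + graphGen G k) * siteOp k pauliZ)

/-- The unit vector `ψ` represents the graph state of `G`: it is fixed by every `U_k`. -/
def IsGraphState {n : ℕ} (G : SimpleGraph (Fin n)) (ψ : QVec n) : Prop :=
  IsUnitVec ψ ∧ ∀ k, graphGen G k *ᵥ ψ = ψ

/-- The vector `Z_1^{i_1} ⋯ Z_n^{i_n} ψ`, which is the graph basis vector with label `i` if `ψ` is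
the graph state. -/
def graphBasisVec {n : ℕ} (ψ : QVec n) (i : Bits n) : QVec n :=
  zOn {k | i k = 1} *ᵥ ψ

/-- The operator that sends the computational basis vector `i` to `graphBasisVec ψ i`. -/
def graphBasisChange {n : ℕ} (ψ : QVec n) : QOp n :=
  Matrix.of fun x i => graphBasisVec ψ i x

/-- The Pauli group of one qubit: `1, X, Y, Z` with the factors `±1, ±i`. -/
def pauliGroupOne : Set (Matrix (Fin 2) (Fin 2) ℂ) :=
  {A | ∃ (ω : ℂ) (P : Matrix (Fin 2) (Fin 2) ℂ), ω ^ 4 = 1 ∧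
    (P = 1 ∨ P = pauliX ∨ P = pauliY ∨ P = pauliZ) ∧ A = ω • P}

/-- The Pauli group of `n` qubits: tensor products of `1, X, Y, Z` with the factors `±1, ±i`. -/
def pauliGroup (n : ℕ) : Set (QOp n) :=
  {A | ∃ (ω : ℂ) (P : Fin n → Matrix (Fin 2) (Fin 2) ℂ), ω ^ 4 = 1 ∧
    (∀ k, P k = 1 ∨ P k = pauliX ∨ P k = pauliY ∨ P k = pauliZ) ∧ A = ω • tensorOp P}

/-- The stabilizer `S(ψ)`: the elements of the Pauli group that fix `ψ`. -/
def pauliStabilizer {n : ℕ} (ψ : QVec n) : Set (QOp n) :=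
  {A | A ∈ pauliGroup n ∧ A *ᵥ ψ = ψ}

/-- The unit vector `ψ` represents a stabilizer state: up to scalars, it is the only vector that is
fixed by its stabilizer. -/
def IsStabilizerState {n : ℕ} (ψ : QVec n) : Prop :=
  IsUnitVec ψ ∧ ∀ φ : QVec n, (∀ A ∈ pauliStabilizer ψ, A *ᵥ φ = φ) → ∃ z : ℂ, φ = z • ψ

/-- One-qubit Clifford operators: unitaries that map the Pauli group to itself by conjugation. -/
def IsCliffordOne (W : Matrix (Fin 2) (Fin 2) ℂ) : Prop :=
  W ∈ Matrix.unitaryGroup (Fin 2) ℂ ∧ ∀ P ∈ pauliGroupOne, W * P * Wᴴ ∈ pauliGroupOne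

/-- `V = V_1 ⊗ ⋯ ⊗ V_n` is a local Clifford operator that takes the graph state `φ` of `G` to
`ψ`. -/
def IsLocalCliffordEquiv {n : ℕ} (V : Fin n → Matrix (Fin 2) (Fin 2) ℂ) (G : SimpleGraph (Fin n))
    (φ ψ : QVec n) : Prop :=
  (∀ k, IsCliffordOne (V k)) ∧ IsGraphState G φ ∧ ψ = tensorOp V *ᵥ φ

end

/-! Graph states. The vectors `graphBasisVec ψ i` are joint eigenvectors of the generators with
pairwise different sign patterns, hence an orthonormal basis. On it `Z_k` flips the label bit `i k`,
and `(1 + U_k) / 2` projects onto the labels with `i k = 0`; so `c_k` is the lowering operator of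
qubit `k` in disguise (`graphJump_eq`), and the process is independent decay of single qubits, seen
through a unitary.

For that decay, `liouvillian_sigmaMinus_apply` shows that the entry `(x, y)` is damped at the rate
`decayRate g x + decayRate g y` and fed only from entries with strictly more excitations. The
generator is thus triangular: at a nonzero entry of maximal weight nothing is gained, so every
eigenvalue is minus such a sum of rates. The sum vanishes only at `(0, 0)`, which gives the unique
stationary state; otherwise it is at least the minimal rate, and `|0⟩⟨e_k|` attains `g k`. Unitary
conjugation transports all this (`dissipation_of_unitary`).

Locality. An operator acts only on `S` exactly when it commutes with all one-qubit operators off `S`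
(`actsOnlyOn_iff_commute`). This criterion is invariant under product unitaries and reads off the
supports.

Stabilizer states. Hadamards are applied until no nontrivial `Z_S` has the state as an eigenvector
(`zLabels_hadamard_ssubset`). By linear duality over `ZMod 2` every `X` part then occurs in the
stabilizer, so for each `k` it contains `±P` with `X` or `Y` at `k` and `1` or `Z` elsewhere. Such
elements cannot anticommute, so the positions of the `Z` form a symmetric relation, that is, a
graph; diagonal Cliffords turn its generators into these elements. -/

/-! ### Calculus of tensor products and one-qubit operators. -/

section Tensor

variable {n : ℕ}

theorem tensorOp_apply (A : Fin n → Matrix (Fin 2) (Fin 2) ℂ) (x y : Bits n) :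
    tensorOp A x y = ∏ k, A k (x k) (y k) := rfl

theorem tensorOp_mul (A B : Fin n → Matrix (Fin 2) (Fin 2) ℂ) :
    tensorOp A * tensorOp B = tensorOp fun k => A k * B k := by
  ext x y
  simp only [Matrix.mul_apply, tensorOp_apply, ← Finset.prod_mul_distrib]
  rw [Finset.prod_univ_sum, Fintype.piFinset_univ]

@[simp]
theorem tensorOp_one : tensorOp (fun _ : Fin n => 1) = 1 := by
  ext x y
  rw [tensorOp_apply]
  by_cases h : x = y
  · subst h; simp
  · obtain ⟨k, hk⟩ := Function.ne_iff.mp h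
    rw [Matrix.one_apply_ne h]
    exact Finset.prod_eq_zero (Finset.mem_univ k) (Matrix.one_apply_ne hk)

theorem tensorOp_conjTranspose (A : Fin n → Matrix (Fin 2) (Fin 2) ℂ) :
    (tensorOp A)ᴴ = tensorOp fun k => (A k)ᴴ := by
  ext x y
  simp [tensorOp_apply, Matrix.conjTranspose_apply]

theorem tensorOp_smul (z : Fin n → ℂ) (A : Fin n → Matrix (Fin 2) (Fin 2) ℂ) :
    tensorOp (fun k => z k • A k) = (∏ k, z k) • tensorOp A := by
  ext x y
  simp [tensorOp_apply, Finset.prod_mul_distrib]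

/-- Signs collected site by site multiply up; all (anti)commutation of Pauli products is decided
this way. -/
theorem tensorOp_mul_eq_smul {A B : Fin n → Matrix (Fin 2) (Fin 2) ℂ} {ε : Fin n → ℂ}
    (h : ∀ k, A k * B k = ε k • (B k * A k)) :
    tensorOp A * tensorOp B = (∏ k, ε k) • (tensorOp B * tensorOp A) := by
  rw [tensorOp_mul, tensorOp_mul, ← tensorOp_smul]
  simp only [h]

theorem tensorOp_mem_unitary {V : Fin n → Matrix (Fin 2) (Fin 2) ℂ}
    (h : ∀ k, V k ∈ Matrix.unitaryGroup (Fin 2) ℂ) :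
    tensorOp V ∈ Matrix.unitaryGroup (Bits n) ℂ := by
  rw [Matrix.mem_unitaryGroup_iff, Matrix.star_eq_conjTranspose, tensorOp_conjTranspose,
    tensorOp_mul]
  have : ∀ k, V k * (V k)ᴴ = 1 := fun k => Matrix.mem_unitaryGroup_iff.mp (h k)
  simp [this]

theorem siteOp_mul (k : Fin n) (A B : Matrix (Fin 2) (Fin 2) ℂ) :
    siteOp k A * siteOp k B = siteOp k (A * B) := by
  rw [siteOp, siteOp, siteOp, tensorOp_mul]
  congr 1
  ext1 j
  by_cases h : j = k
  · subst h; simp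
  · simp [h]

@[simp]
theorem siteOp_one (k : Fin n) : siteOp k (1 : Matrix (Fin 2) (Fin 2) ℂ) = 1 := by
  rw [siteOp, Function.update_eq_self_iff.mpr rfl, tensorOp_one]

theorem siteOp_conjTranspose (k : Fin n) (A : Matrix (Fin 2) (Fin 2) ℂ) :
    (siteOp k A)ᴴ = siteOp k Aᴴ := by
  rw [siteOp, siteOp, tensorOp_conjTranspose]
  congr 1
  ext1 j
  by_cases h : j = k
  · subst h; simp
  · simp [h]

theorem commute_siteOp {j k : Fin n} (h : j ≠ k) (A B : Matrix (Fin 2) (Fin 2) ℂ) :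
    Commute (siteOp j A) (siteOp k B) := by
  rw [commute_iff_eq, siteOp, siteOp, tensorOp_mul, tensorOp_mul]
  congr 1
  ext1 l
  by_cases hj : l = j
  · subst hj; simp [h]
  · simp [hj]

theorem siteOp_apply (k : Fin n) (A : Matrix (Fin 2) (Fin 2) ℂ) (x y : Bits n) :
    siteOp k A x y = if Function.update x k (y k) = y then A (x k) (y k) else 0 := by
  rw [siteOp, tensorOp_apply]
  split_ifs with h
  · rw [Finset.prod_eq_single k _ (by simp)]
    · simp
    · intro j _ hj
      have : x j = y j := by rw [← h]; simp [hj]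
      simp [hj, this]
  · obtain ⟨j, hj⟩ := Function.ne_iff.mp h
    have hjk : j ≠ k := by rintro rfl; simp at hj
    refine Finset.prod_eq_zero (Finset.mem_univ j) ?_
    simp only [Function.update_of_ne hjk] at hj ⊢
    exact Matrix.one_apply_ne hj

theorem siteOp_mul_apply (k : Fin n) (A : Matrix (Fin 2) (Fin 2) ℂ) (M : QOp n) (x y : Bits n) :
    (siteOp k A * M) x y = ∑ b, A (x k) b * M (Function.update x k b) y := by
  rw [Matrix.mul_apply]
  simp only [siteOp_apply]
  symm
  refine Finset.sum_of_injOn (fun b => Function.update x k b) ?_ (by simp) ?_ ?_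
  · intro b _ c _ h
    simpa using congrFun h k
  · intro z _ hz
    rw [if_neg, zero_mul]
    intro h
    exact hz ⟨z k, by simp, h⟩
  · intro b _
    simp

theorem mul_siteOp_apply (k : Fin n) (A : Matrix (Fin 2) (Fin 2) ℂ) (M : QOp n) (x y : Bits n) :
    (M * siteOp k A) x y = ∑ b, M x (Function.update y k b) * A b (y k) := by
  rw [Matrix.mul_apply]
  simp only [siteOp_apply]
  symm
  refine Finset.sum_of_injOn (fun b => Function.update y k b) ?_ (by simp) ?_ ?_
  · intro b _ c _ h
    simpa using congrFun h k
  · intro z _ hz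
    rw [if_neg, mul_zero]
    intro h
    exact hz ⟨z k, by simp, by rw [← h]; simp⟩
  · intro b _
    simp

theorem siteOp_eq_tensorOp (k : Fin n) (A : Matrix (Fin 2) (Fin 2) ℂ) :
    siteOp k A = tensorOp fun j => if j = k then A else 1 := by
  rw [siteOp]
  congr 1
  ext1 j
  by_cases h : j = k
  · subst h; simp
  · simp [h]

/-- Away from `k` the factors cancel, so a product unitary keeps one-qubit operators at their site;
this makes supports invariant under it. -/
theorem tensorOp_mul_siteOp_mul {V : Fin n → Matrix (Fin 2) (Fin 2) ℂ}
    (h : ∀ k, V k ∈ Matrix.unitaryGroup (Fin 2) ℂ) (k : Fin n) (A : Matrix (Fin 2) (Fin 2) ℂ) :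
    (tensorOp V)ᴴ * siteOp k A * tensorOp V = siteOp k ((V k)ᴴ * A * V k) := by
  have hV : ∀ k, (V k)ᴴ * V k = 1 := fun k => Matrix.mem_unitaryGroup_iff'.mp (h k)
  rw [tensorOp_conjTranspose, siteOp_eq_tensorOp, siteOp_eq_tensorOp, tensorOp_mul, tensorOp_mul]
  congr 1
  ext1 j
  by_cases hj : j = k
  · subst hj; simp
  · simp [hj, hV]

end Tensor

/-! ### Relations between Pauli matrices. -/

section Pauli

theorem pauliX_mul_self : pauliX * pauliX = 1 := by
  ext i j; fin_cases i <;> fin_cases j <;> simp [pauliX, Matrix.mul_apply]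

theorem pauliY_mul_self : pauliY * pauliY = 1 := by
  ext i j; fin_cases i <;> fin_cases j <;> simp [pauliY, Matrix.mul_apply]

theorem pauliZ_mul_self : pauliZ * pauliZ = 1 := by
  ext i j; fin_cases i <;> fin_cases j <;> simp [pauliZ, Matrix.mul_apply]

theorem pauliX_mul_pauliZ : pauliX * pauliZ = (-1 : ℂ) • (pauliZ * pauliX) := by
  ext i j; fin_cases i <;> fin_cases j <;> simp [pauliX, pauliZ, Matrix.mul_apply]

theorem pauliZ_mul_pauliX : pauliZ * pauliX = (-1 : ℂ) • (pauliX * pauliZ) := by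
  rw [pauliX_mul_pauliZ]; simp

theorem pauliX_conjTranspose : pauliXᴴ = pauliX := by
  ext i j; fin_cases i <;> fin_cases j <;> simp [pauliX]

theorem pauliZ_conjTranspose : pauliZᴴ = pauliZ := by
  ext i j; fin_cases i <;> fin_cases j <;> simp [pauliZ]

end Pauli

/-! ### Spectrum and kernel of independent decay, and their transport by unitaries. -/

section Dissipation

variable {n : ℕ}

theorem liouvillian_apply (g : Fin n → ℝ) (c : Fin n → QOp n) (ρ : QOp n) :
    liouvillian g c ρ = ∑ k, (g k : ℂ) •
      ((2 : ℂ) • (c k * ρ * (c k)ᴴ) - (c k)ᴴ * c k * ρ - ρ * ((c k)ᴴ * c k)) := rfl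

/-- The total rate at which the excitations of the bit string `x` decay. -/
def decayRate (g : Fin n → ℝ) (x : Bits n) : ℝ := ∑ k, g k * ((x k : ℕ) : ℝ)

/-- Loss is diagonal in the matrix entries, and gain comes only from entries with bit `k` raised in
both labels. This is the triangular structure behind the spectrum. -/
theorem liouvillian_sigmaMinus_apply (g : Fin n → ℝ) (ρ : QOp n) (x y : Bits n) :
    liouvillian g (fun k => siteOp k sigmaMinus) ρ x y =
      (∑ k, (g k : ℂ) * (2 * if x k = 0 ∧ y k = 0 then
        ρ (Function.update x k 1) (Function.update y k 1) else 0)) -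
      ((decayRate g x + decayRate g y : ℝ) : ℂ) * ρ x y := by
  have h : sigmaMinusᴴ * sigmaMinus = !![0, 0; 0, 1] := by
    ext i j; fin_cases i <;> fin_cases j <;> simp [sigmaMinus, Matrix.mul_apply]
  rw [liouvillian_apply, Matrix.sum_apply, decayRate, decayRate, ← Finset.sum_add_distrib]
  push_cast
  rw [Finset.sum_mul, ← Finset.sum_sub_distrib]
  refine Finset.sum_congr rfl fun k _ => ?_
  rw [siteOp_conjTranspose, siteOp_mul, h]
  simp only [Matrix.smul_apply, Matrix.sub_apply, mul_siteOp_apply, siteOp_mul_apply,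
    Fin.sum_univ_two, smul_eq_mul]
  have hx : x k = 0 ∨ x k = 1 := by omega
  have hy : y k = 0 ∨ y k = 1 := by omega
  have ux : ∀ b, x k = b → Function.update x k b = x := by rintro b rfl; simp
  have uy : ∀ b, y k = b → Function.update y k b = y := by rintro b rfl; simp
  rcases hx with hx | hx <;> rcases hy with hy | hy <;>
    (simp [hx, hy, ux _ hx, uy _ hy, sigmaMinus]; try ring)

/-- The number of excitations of the bit string `x`. -/
def bitWeight (x : Bits n) : ℕ := ∑ k, (x k : ℕ)

theorem bitWeight_lt_update {x : Bits n} {k : Fin n} (h : x k = 0) :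
    bitWeight x < bitWeight (Function.update x k 1) := by
  refine Finset.sum_lt_sum (fun j _ => ?_) ⟨k, Finset.mem_univ k, by simp [h]⟩
  by_cases hj : j = k
  · subst hj; simp [h]
  · simp [hj]

theorem bitWeight_eq_zero {x : Bits n} : bitWeight x = 0 ↔ x = 0 := by
  simp [bitWeight, funext_iff]

theorem decayRate_nonneg {g : Fin n → ℝ} (hg : ∀ k, 0 < g k) (x : Bits n) : 0 ≤ decayRate g x :=
  Finset.sum_nonneg fun k _ => mul_nonneg (hg k).le (Nat.cast_nonneg _)

theorem le_decayRate {g : Fin n → ℝ} (hg : ∀ k, 0 < g k) {x : Bits n} {m : ℝ}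
    (hm : ∀ k, m ≤ g k) (hx : x ≠ 0) : m ≤ decayRate g x := by
  obtain ⟨k, hk⟩ := Function.ne_iff.mp hx
  have hk : x k = 1 := by have : x k ≠ 0 := hk; omega
  refine (hm k).trans ?_
  have := Finset.single_le_sum (f := fun k => g k * ((x k : ℕ) : ℝ))
    (fun k _ => mul_nonneg (hg k).le (Nat.cast_nonneg _)) (Finset.mem_univ k)
  simpa [hk, decayRate] using this

/-- An eigenvector has a nonzero entry of maximal weight, where the gain term vanishes. -/
theorem exists_maximal_entry {g : Fin n → ℝ} {μ : ℂ} {ρ : QOp n} (hρ : ρ ≠ 0)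
    (h : liouvillian g (fun k => siteOp k sigmaMinus) ρ = μ • ρ) :
    ∃ x y : Bits n, μ = -((decayRate g x + decayRate g y : ℝ) : ℂ) ∧
      ∀ x' y', ρ x' y' ≠ 0 → bitWeight x' + bitWeight y' ≤ bitWeight x + bitWeight y := by
  classical
  let s : Finset (Bits n × Bits n) := Finset.univ.filter fun p => ρ p.1 p.2 ≠ 0
  have hs : s.Nonempty := by
    by_contra hne
    rw [Finset.not_nonempty_iff_eq_empty] at hne
    refine hρ (Matrix.ext fun x y => ?_)
    by_contra hxy
    have : (x, y) ∈ s := by simpa [s] using hxy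
    simp [hne] at this
  obtain ⟨⟨x, y⟩, hxy, hmax⟩ := s.exists_max_image (fun p => bitWeight p.1 + bitWeight p.2) hs
  have hxy : ρ x y ≠ 0 := by simpa [s] using hxy
  have hmax : ∀ x' y', ρ x' y' ≠ 0 →
      bitWeight x' + bitWeight y' ≤ bitWeight x + bitWeight y := fun x' y' h' =>
    hmax (x', y') (by simpa [s] using h')
  refine ⟨x, y, ?_, hmax⟩
  have he := congrFun (congrFun h x) y
  rw [liouvillian_sigmaMinus_apply, Finset.sum_eq_zero, Matrix.smul_apply, smul_eq_mul,
    zero_sub, ← neg_mul] at he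
  · exact (mul_right_cancel₀ hxy he).symm
  · intro k _
    split_ifs with hk
    · by_cases h0 : ρ (Function.update x k 1) (Function.update y k 1) = 0
      · simp [h0]
      · have h1 := hmax _ _ h0
        have h2 := bitWeight_lt_update hk.1
        have h3 := bitWeight_lt_update hk.2
        omega
    · simp

theorem eigenvalue_sigmaMinus {g : Fin n → ℝ} {μ : ℂ}
    (h : (liouvillian g fun k => siteOp k sigmaMinus).HasEigenvalue μ) :
    ∃ x y : Bits n, μ = -((decayRate g x + decayRate g y : ℝ) : ℂ) := by
  obtain ⟨ρ, hρ⟩ := h.exists_hasEigenvector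
  obtain ⟨x, y, hμ, -⟩ := exists_maximal_entry hρ.2 hρ.apply_eq_smul
  exact ⟨x, y, hμ⟩

theorem eq_zero_of_decayRate_eq_zero {g : Fin n → ℝ} (hg : ∀ k, 0 < g k) {x : Bits n}
    (h : decayRate g x = 0) : x = 0 := by
  have h' := (Finset.sum_eq_zero_iff_of_nonneg
    (fun k _ => mul_nonneg (hg k).le (Nat.cast_nonneg _))).mp h
  ext1 k
  have := h' k (Finset.mem_univ k)
  simpa [(hg k).ne'] using this

/-- Positivity plays no role: the kernel on all operators is already a line. -/
theorem liouvillian_sigmaMinus_eq_zero_iff {g : Fin n → ℝ} (hg : ∀ k, 0 < g k) (ρ : QOp n) :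
    liouvillian g (fun k => siteOp k sigmaMinus) ρ = 0 ↔
      ρ = ρ 0 0 • ketBra (Pi.single (0 : Bits n) (1 : ℂ)) := by
  have key : ketBra (Pi.single (0 : Bits n) (1 : ℂ)) = Matrix.single 0 0 1 := by
    ext x y
    simp only [ketBra, Matrix.vecMulVec_apply, Matrix.single_apply, Pi.single_apply, Pi.star_apply]
    by_cases hx : x = 0 <;> by_cases hy : y = 0 <;> simp [hx, hy, eq_comm]
  rw [key]
  constructor
  · intro h
    by_cases hρ : ρ = 0
    · simp [hρ]
    -- With eigenvalue `0` the maximal entry must be `(0, 0)`, so maximality leaves no other nonzero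
    -- entry.
    obtain ⟨x, y, hμ, hmax⟩ := exists_maximal_entry (μ := 0) hρ (by simpa using h)
    have h0 : decayRate g x + decayRate g y = 0 := by
      have := neg_eq_zero.mp hμ.symm
      exact_mod_cast this
    have hx := eq_zero_of_decayRate_eq_zero hg (x := x)
      (by linarith [decayRate_nonneg hg x, decayRate_nonneg hg y])
    have hy := eq_zero_of_decayRate_eq_zero hg (x := y)
      (by linarith [decayRate_nonneg hg x, decayRate_nonneg hg y])
    ext a b
    by_cases hab : a = 0 ∧ b = 0
    · simp [hab.1, hab.2]
    · have : ρ a b = 0 := by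
        by_contra hne
        have := hmax a b hne
        rw [hx, hy, bitWeight_eq_zero.mpr rfl, add_zero] at this
        exact hab ⟨bitWeight_eq_zero.mp (by omega), bitWeight_eq_zero.mp (by omega)⟩
      rw [this, Matrix.smul_apply, Matrix.single_apply, if_neg]
      · simp
      · rintro ⟨rfl, rfl⟩; exact hab ⟨rfl, rfl⟩
  · intro h
    rw [h]
    ext x y
    rw [liouvillian_sigmaMinus_apply, Finset.sum_eq_zero]
    · by_cases hxy : x = 0 ∧ y = 0
      · simp [hxy.1, hxy.2, decayRate]
      · rw [Matrix.smul_apply, Matrix.single_apply, if_neg]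
        · simp
        · rintro ⟨rfl, rfl⟩; exact hxy ⟨rfl, rfl⟩
    · intro k _
      have h1 : (0 : Bits n) ≠ Function.update x k 1 := fun h => by simpa using congrFun h k
      simp [h1]

/-- The eigenvector is `|0⟩⟨e_k|`: gain would need an entry in a nonzero row, and the loss rate is
`0 + g k`. -/
theorem hasEigenvalue_sigmaMinus (g : Fin n → ℝ) (k : Fin n) :
    (liouvillian g fun k => siteOp k sigmaMinus).HasEigenvalue (-(g k : ℂ)) := by
  refine Module.End.hasEigenvalue_of_hasEigenvector
    (x := Matrix.single (0 : Bits n) (Pi.single k 1) (1 : ℂ)) ⟨?_, ?_⟩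
  · rw [Module.End.mem_eigenspace_iff]
    ext x y
    rw [liouvillian_sigmaMinus_apply, Finset.sum_eq_zero]
    · by_cases hxy : 0 = x ∧ Pi.single k 1 = y
      · rw [← hxy.1, ← hxy.2]
        have : ∑ j, g j * (((Pi.single k 1 : Bits n) j : ℕ) : ℝ) = g k := by
          rw [Finset.sum_eq_single k] <;> simp +contextual
        simp [decayRate, this]
      · simp [hxy]
    · intro j _
      have h1 : (0 : Bits n) ≠ Function.update x j 1 := fun h => by simpa using congrFun h j
      simp [h1]
  · intro h
    simpa using congrFun (congrFun h 0) (Pi.single k 1)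

theorem liouvillian_conj {W : QOp n} (hW : W ∈ Matrix.unitaryGroup (Bits n) ℂ) (g : Fin n → ℝ)
    (c : Fin n → QOp n) (ρ : QOp n) :
    liouvillian g (fun k => W * c k * Wᴴ) (W * ρ * Wᴴ) = W * liouvillian g c ρ * Wᴴ := by
  have h : ∀ A, Wᴴ * (W * A) = A := fun A => by
    rw [← mul_assoc, ← Matrix.star_eq_conjTranspose, Matrix.mem_unitaryGroup_iff'.mp hW, one_mul]
  rw [liouvillian_apply, liouvillian_apply, Finset.mul_sum, Finset.sum_mul]
  refine Finset.sum_congr rfl fun k _ => ?_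
  simp only [Matrix.conjTranspose_mul, Matrix.conjTranspose_conjTranspose, mul_assoc, h, mul_sub,
    sub_mul, mul_smul_comm, smul_mul_assoc]

theorem liouvillian_conj' {W : QOp n} (hW : W ∈ Matrix.unitaryGroup (Bits n) ℂ) (g : Fin n → ℝ)
    (c : Fin n → QOp n) (ρ : QOp n) :
    liouvillian g c (Wᴴ * ρ * W) = Wᴴ * liouvillian g (fun k => W * c k * Wᴴ) ρ * W := by
  have h : Wᴴ * W = 1 := Matrix.mem_unitaryGroup_iff'.mp hW
  have hW' : Wᴴ ∈ Matrix.unitaryGroup (Bits n) ℂ := by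
    rw [Matrix.mem_unitaryGroup_iff, Matrix.star_eq_conjTranspose, Matrix.conjTranspose_conjTranspose, h]
  have := liouvillian_conj hW' g (fun k => W * c k * Wᴴ) ρ
  rw [Matrix.conjTranspose_conjTranspose] at this
  rw [← this]
  congr 2
  ext1 k
  rw [← mul_assoc, ← mul_assoc, h, one_mul, mul_assoc, h, mul_one]

theorem hasEigenvalue_liouvillian_conj {W : QOp n} (hW : W ∈ Matrix.unitaryGroup (Bits n) ℂ)
    (g : Fin n → ℝ) (c : Fin n → QOp n) (μ : ℂ) :
    (liouvillian g fun k => W * c k * Wᴴ).HasEigenvalue μ ↔ (liouvillian g c).HasEigenvalue μ := by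
  have h : Wᴴ * W = 1 := Matrix.mem_unitaryGroup_iff'.mp hW
  have h' : W * Wᴴ = 1 := Matrix.mem_unitaryGroup_iff.mp hW
  constructor <;> intro hμ <;> obtain ⟨ρ, hρ⟩ := hμ.exists_hasEigenvector
  · refine Module.End.hasEigenvalue_of_hasEigenvector (x := Wᴴ * ρ * W)
      ⟨Module.End.mem_eigenspace_iff.mpr ?_, fun h0 => hρ.2 ?_⟩
    · rw [liouvillian_conj' hW, hρ.apply_eq_smul, mul_smul_comm, smul_mul_assoc]
    · calc ρ = (W * Wᴴ) * ρ * (W * Wᴴ) := by rw [h', one_mul, mul_one]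
        _ = W * (Wᴴ * ρ * W) * Wᴴ := by simp only [mul_assoc]
        _ = 0 := by rw [h0]; simp
  · refine Module.End.hasEigenvalue_of_hasEigenvector (x := W * ρ * Wᴴ)
      ⟨Module.End.mem_eigenspace_iff.mpr ?_, fun h0 => hρ.2 ?_⟩
    · rw [liouvillian_conj hW, hρ.apply_eq_smul, mul_smul_comm, smul_mul_assoc]
    · calc ρ = (Wᴴ * W) * ρ * (Wᴴ * W) := by rw [h, one_mul, mul_one]
        _ = Wᴴ * (W * ρ * Wᴴ) * W := by simp only [mul_assoc]
        _ = 0 := by rw [h0]; simp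

theorem ketBra_mulVec (W : QOp n) (ψ : QVec n) : ketBra (W *ᵥ ψ) = W * ketBra ψ * Wᴴ := by
  rw [ketBra, ketBra, Matrix.star_mulVec, Matrix.mul_vecMulVec, Matrix.vecMulVec_mul]

theorem trace_ketBra (ψ : QVec n) : (ketBra ψ).trace = star ψ ⬝ᵥ ψ := by
  rw [ketBra, Matrix.trace_vecMulVec, dotProduct_comm]

theorem isDensity_ketBra {ψ : QVec n} (h : IsUnitVec ψ) : IsDensity (ketBra ψ) :=
  ⟨Matrix.posSemidef_vecMulVec_self_star ψ, (trace_ketBra ψ).trans h⟩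

/-- The purely dissipative process whose jump operators are unitarily equivalent to the lowering
operators of the single qubits. -/
theorem dissipation_of_unitary {W : QOp n} (hW : W ∈ Matrix.unitaryGroup (Bits n) ℂ) {ψ : QVec n}
    (hψ : IsUnitVec ψ) (h0 : W *ᵥ Pi.single 0 1 = ψ) {c : Fin n → QOp n}
    (hc : ∀ k, c k = W * siteOp k sigmaMinus * Wᴴ) {g : Fin n → ℝ} (hg : ∀ k, 0 < g k) :
    IsUniqueStationaryState (liouvillian g c) ψ ∧
      NoPurelyImaginaryEigenvalue (liouvillian g c) ∧
      ∀ m : ℝ, IsLeast (Set.range g) m → IsRelaxationTime (liouvillian g c) (1 / m) := by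
  obtain rfl : c = fun k => W * siteOp k sigmaMinus * Wᴴ := funext hc
  have h : Wᴴ * W = 1 := Matrix.mem_unitaryGroup_iff'.mp hW
  have h' : W * Wᴴ = 1 := Matrix.mem_unitaryGroup_iff.mp hW
  refine ⟨⟨isDensity_ketBra hψ, fun ρ hρ => ⟨fun hL => ?_, ?_⟩⟩, fun μ hμ hre => ?_, ?_⟩
  · have h1 : liouvillian g (fun k => siteOp k sigmaMinus) (Wᴴ * ρ * W) = 0 := by
      rw [liouvillian_conj' hW, hL]; simp
    rw [liouvillian_sigmaMinus_eq_zero_iff hg] at h1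
    set z := (Wᴴ * ρ * W) 0 0
    have h2 : ρ = z • ketBra ψ := by
      calc ρ = (W * Wᴴ) * ρ * (W * Wᴴ) := by rw [h', one_mul, mul_one]
        _ = W * (Wᴴ * ρ * W) * Wᴴ := by simp only [mul_assoc]
        _ = z • ketBra ψ := by
          rw [h1, mul_smul_comm, smul_mul_assoc, ← ketBra_mulVec, h0]
    -- Trace one on both sides fixes the scalar.
    have h3 := hρ.2
    rw [h2, Matrix.trace_smul, trace_ketBra, hψ, smul_eq_mul, mul_one] at h3
    rw [h2, h3, one_smul]
  · rintro rfl
    rw [← h0, ketBra_mulVec, liouvillian_conj hW,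
      (liouvillian_sigmaMinus_eq_zero_iff hg _).mpr (by simp [ketBra, Matrix.vecMulVec_apply])]
    simp
  · rw [hasEigenvalue_liouvillian_conj hW] at hμ
    obtain ⟨x, y, rfl⟩ := eigenvalue_sigmaMinus hμ
    have : decayRate g x + decayRate g y = 0 := by
      rw [Complex.neg_re, Complex.ofReal_re] at hre; linarith
    simp [this]
  -- For `n = 0` there is no least rate and the claim is vacuous; otherwise it is some `g k`.
  · rintro m ⟨⟨k, rfl⟩, hm⟩
    refine ⟨g k, hg k, ⟨⟨-(g k : ℂ), ?_, by simpa using (hg k).ne', by simp⟩, ?_⟩, rfl⟩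
    · rw [hasEigenvalue_liouvillian_conj hW]
      exact hasEigenvalue_sigmaMinus g k
    · rintro _ ⟨μ, hμ, hne, rfl⟩
      rw [hasEigenvalue_liouvillian_conj hW] at hμ
      obtain ⟨x, y, rfl⟩ := eigenvalue_sigmaMinus hμ
      have hm' : ∀ j, g k ≤ g j := fun j => hm ⟨j, rfl⟩
      have hx := decayRate_nonneg hg x
      have hy := decayRate_nonneg hg y
      rw [Complex.neg_re, neg_neg, Complex.ofReal_re]
      -- A nonzero eigenvalue has a nonzero label on at least one side, and that side alone
      -- contributes the minimal rate.
      by_cases hx0 : x = 0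
      · by_cases hy0 : y = 0
        · subst hx0 hy0
          simp [decayRate] at hne
        · linarith [le_decayRate hg hm' hy0]
      · linarith [le_decayRate hg hm' hx0]

end Dissipation

/-! ### Graph states, the graph basis and the jump operators in it. -/

section GraphState

variable {n : ℕ}

/-- The tensor factors of `graphGen G k`. -/
noncomputable def graphFactor (G : SimpleGraph (Fin n)) (k j : Fin n) : Matrix (Fin 2) (Fin 2) ℂ :=
  open Classical in if j = k then pauliX else if G.Adj k j then pauliZ else 1

theorem graphGen_eq (G : SimpleGraph (Fin n)) (k : Fin n) :
    graphGen G k = tensorOp (graphFactor G k) := by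
  rw [graphGen, siteOp_eq_tensorOp, zOn, tensorOp_mul]
  congr 1
  ext1 j
  by_cases h : j = k
  · subst h; simp [graphFactor]
  · by_cases ha : G.Adj k j <;> simp [graphFactor, h, ha]

theorem graphGen_mul_self (G : SimpleGraph (Fin n)) (k : Fin n) :
    graphGen G k * graphGen G k = 1 := by
  have : ∀ j, graphFactor G k j * graphFactor G k j = 1 := fun j => by
    unfold graphFactor
    split_ifs
    · exact pauliX_mul_self
    · exact pauliZ_mul_self
    · exact one_mul 1
  rw [graphGen_eq, tensorOp_mul]
  simp [this]

theorem graphGen_conjTranspose (G : SimpleGraph (Fin n)) (k : Fin n) :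
    (graphGen G k)ᴴ = graphGen G k := by
  have : ∀ j, (graphFactor G k j)ᴴ = graphFactor G k j := fun j => by
    unfold graphFactor
    split_ifs
    · exact pauliX_conjTranspose
    · exact pauliZ_conjTranspose
    · exact Matrix.conjTranspose_one
  rw [graphGen_eq, tensorOp_conjTranspose]
  simp only [this]

theorem zOn_mul_zOn_self (S : Set (Fin n)) : zOn S * zOn S = 1 := by
  classical
  rw [zOn, tensorOp_mul, ← tensorOp_one]
  congr 1
  ext1 j
  by_cases h : j ∈ S <;> simp [h, pauliZ_mul_self]

theorem zOn_conjTranspose (S : Set (Fin n)) : (zOn S)ᴴ = zOn S := by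
  classical
  rw [zOn, tensorOp_conjTranspose]
  congr 1
  ext1 j
  by_cases h : j ∈ S <;> simp [h, pauliZ_conjTranspose]

@[simp]
theorem zOn_empty : zOn (∅ : Set (Fin n)) = 1 := by
  simp [zOn]

theorem siteOp_pauliZ_eq_zOn (k : Fin n) : siteOp k pauliZ = zOn {k} := by
  rw [siteOp_eq_tensorOp, zOn]
  simp

theorem siteOp_pauliZ_mul_zOn (k : Fin n) (x : Bits n) :
    siteOp k pauliZ * zOn {j | x j = 1} =
      zOn {j | Function.update x k (1 - x k) j = 1} := by
  rw [siteOp_eq_tensorOp, zOn, zOn, tensorOp_mul]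
  congr 1
  ext1 j
  by_cases h : j = k
  · subst h
    have : x j = 0 ∨ x j = 1 := by omega
    rcases this with h | h <;> simp [h, pauliZ_mul_self]
  · simp [h]

open Classical in
-- Only the factor `X` at site `k` can fail to commute with a product of `Z` operators.
theorem graphGen_mul_zOn (G : SimpleGraph (Fin n)) (k : Fin n) (S : Set (Fin n)) :
    graphGen G k * zOn S = (if k ∈ S then (-1 : ℂ) else 1) • (zOn S * graphGen G k) := by
  rw [graphGen_eq, zOn, tensorOp_mul_eq_smul
    (ε := fun j => if j = k then (if k ∈ S then (-1 : ℂ) else 1) else 1)]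
  · simp
  · intro j
    unfold graphFactor
    by_cases hj : j = k
    · subst hj
      by_cases hS : j ∈ S
      · simpa [hS] using pauliX_mul_pauliZ
      · simp [hS]
    · by_cases hS : j ∈ S <;> by_cases ha : G.Adj k j <;> simp [hj, hS, ha]

/-- For adjacent vertices the factors anticommute at exactly the two sites `j` and `k`, and the
signs cancel; for nonadjacent ones they commute everywhere. -/
theorem commute_graphGen (G : SimpleGraph (Fin n)) (j k : Fin n) :
    Commute (graphGen G j) (graphGen G k) := by
  classical
  by_cases hjk : j = k
  · rw [hjk]
  by_cases ha : G.Adj j k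
  · have hprod : ∏ l : Fin n, (if l = j then (-1 : ℂ) else 1) * (if l = k then (-1 : ℂ) else 1)
        = 1 := by
      rw [Finset.prod_mul_distrib]; simp
    rw [commute_iff_eq, graphGen_eq, graphGen_eq, tensorOp_mul_eq_smul (ε := fun l =>
      (if l = j then (-1 : ℂ) else 1) * (if l = k then (-1 : ℂ) else 1)), hprod, one_smul]
    intro l
    unfold graphFactor
    by_cases hlj : l = j
    · subst hlj
      simpa [hjk, ha.symm] using pauliX_mul_pauliZ
    by_cases hlk : l = k
    · subst hlk
      simpa [hlj, ha] using pauliZ_mul_pauliX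
    · by_cases h1 : G.Adj j l <;> by_cases h2 : G.Adj k l <;> simp [hlj, hlk, h1, h2]
  · rw [commute_iff_eq, graphGen_eq, graphGen_eq, tensorOp_mul_eq_smul (ε := fun _ => 1)]
    · simp
    intro l
    unfold graphFactor
    by_cases hlj : l = j
    · subst hlj
      simp [hjk, mt SimpleGraph.Adj.symm ha]
    by_cases hlk : l = k
    · subst hlk
      simp [hlj, ha]
    · by_cases h1 : G.Adj j l <;> by_cases h2 : G.Adj k l <;> simp [hlj, hlk, h1, h2]

/-- A common fixed vector of the generators is built one generator at a time. -/
theorem exists_fixed_graphGen (G : SimpleGraph (Fin n)) (S : Finset (Fin n)) :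
    ∃ v : QVec n, v ≠ 0 ∧ ∀ k ∈ S, graphGen G k *ᵥ v = v := by
  classical
  induction S using Finset.induction_on with
  | empty => exact ⟨Pi.single 0 1, by simp, by simp⟩
  | insert k S hk ih =>
    obtain ⟨v, hv, h⟩ := ih
    -- Either `(1 + U_k) v` is nonzero and fixed by `U_k`, or `U_k v = -v`; then `Z_k` corrects the
    -- sign without disturbing the other generators.
    by_cases hw : v + graphGen G k *ᵥ v = 0
    · have hneg : graphGen G k *ᵥ v = -v := by
        rw [add_comm] at hw; exact eq_neg_of_add_eq_zero_left hw
      refine ⟨zOn {k} *ᵥ v, fun h0 => hv ?_, fun j hj => ?_⟩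
      · have := congrArg (zOn {k} *ᵥ ·) h0
        simpa [Matrix.mulVec_mulVec, zOn_mul_zOn_self] using this
      · rw [Matrix.mulVec_mulVec, graphGen_mul_zOn, Matrix.smul_mulVec, ← Matrix.mulVec_mulVec]
        rcases Finset.mem_insert.mp hj with rfl | hjS
        · simp [hneg, Matrix.mulVec_neg]
        · have hne : j ≠ k := by rintro rfl; exact hk hjS
          simp [hne, h j hjS]
    · refine ⟨_, hw, fun j hj => ?_⟩
      rcases Finset.mem_insert.mp hj with rfl | hj
      · rw [Matrix.mulVec_add, Matrix.mulVec_mulVec, graphGen_mul_self, Matrix.one_mulVec, add_comm]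
      · rw [Matrix.mulVec_add, Matrix.mulVec_mulVec, (commute_graphGen G j k).eq,
          ← Matrix.mulVec_mulVec, h j hj]

theorem exists_isUnitVec_smul {v : QVec n} (hv : v ≠ 0) : ∃ z : ℂ, IsUnitVec (z • v) := by
  have h := Matrix.dotProduct_star_self_pos_iff.mpr hv
  obtain ⟨hre, him⟩ := Complex.pos_iff.mp h
  refine ⟨((Real.sqrt (star v ⬝ᵥ v).re)⁻¹ : ℝ), ?_⟩
  have hv' : star v ⬝ᵥ v = ((star v ⬝ᵥ v).re : ℂ) := Complex.ext rfl (by simp [← him])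
  rw [IsUnitVec, star_smul, smul_dotProduct, dotProduct_smul, smul_eq_mul, smul_eq_mul]
  set r := (star v ⬝ᵥ v).re
  rw [hv', Complex.star_def, Complex.conj_ofReal]
  norm_cast
  have h1 := Real.sq_sqrt hre.le
  have h2 := (Real.sqrt_pos.mpr hre).ne'
  field_simp
  rw [h1]

theorem exists_isGraphState (G : SimpleGraph (Fin n)) : ∃ ψ : QVec n, IsGraphState G ψ := by
  obtain ⟨v, hv, h⟩ := exists_fixed_graphGen G Finset.univ
  obtain ⟨z, hz⟩ := exists_isUnitVec_smul hv
  exact ⟨z • v, hz, fun k => by rw [Matrix.mulVec_smul, h k (Finset.mem_univ k)]⟩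

theorem graphGen_mulVec_graphBasisVec {G : SimpleGraph (Fin n)} {ψ : QVec n}
    (h : ∀ k, graphGen G k *ᵥ ψ = ψ) (k : Fin n) (i : Bits n) :
    graphGen G k *ᵥ graphBasisVec ψ i = (-1 : ℂ) ^ (i k : ℕ) • graphBasisVec ψ i := by
  rw [graphBasisVec, Matrix.mulVec_mulVec, graphGen_mul_zOn, Matrix.smul_mulVec,
    ← Matrix.mulVec_mulVec, h]
  congr 1
  have : i k = 0 ∨ i k = 1 := by omega
  rcases this with h | h <;> simp [h]

theorem dotProduct_mulVec_unitary {W : QOp n} (hW : Wᴴ * W = 1) (v w : QVec n) :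
    star (W *ᵥ v) ⬝ᵥ (W *ᵥ w) = star v ⬝ᵥ w := by
  rw [Matrix.star_mulVec, Matrix.dotProduct_mulVec, Matrix.vecMul_vecMul, hW, Matrix.vecMul_one]

/-- Eigenvectors of a generator with different eigenvalues are orthogonal. -/
theorem dotProduct_graphGen_eq_zero (G : SimpleGraph (Fin n)) (k : Fin n) {v w : QVec n} {a b : ℕ}
    (hv : graphGen G k *ᵥ v = (-1 : ℂ) ^ a • v) (hw : graphGen G k *ᵥ w = (-1 : ℂ) ^ b • w)
    (hab : Odd (a + b)) : star v ⬝ᵥ w = 0 := by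
  have hU : (graphGen G k)ᴴ * graphGen G k = 1 := by
    rw [graphGen_conjTranspose, graphGen_mul_self]
  -- The unitary generator preserves the inner product, yet multiplies it by `(-1) ^ (a + b) = -1`.
  have h := dotProduct_mulVec_unitary hU v w
  rw [hv, hw, star_smul, smul_dotProduct, dotProduct_smul, smul_smul, star_pow, star_neg, star_one,
    ← pow_add, hab.neg_one_pow, neg_one_smul] at h
  have h2 : (2 : ℂ) * (star v ⬝ᵥ w) = 0 := by linear_combination -h
  simpa using h2

theorem graphBasisVec_unit {ψ : QVec n} (h : IsUnitVec ψ) (i : Bits n) :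
    IsUnitVec (graphBasisVec ψ i) := by
  rw [IsUnitVec, graphBasisVec, dotProduct_mulVec_unitary, h]
  rw [zOn_conjTranspose, zOn_mul_zOn_self]

theorem conjTranspose_graphBasisChange_mulVec (ψ φ : QVec n) (i : Bits n) :
    ((graphBasisChange ψ)ᴴ *ᵥ φ) i = star (graphBasisVec ψ i) ⬝ᵥ φ := rfl

theorem graphBasisChange_mulVec_single (ψ : QVec n) (i : Bits n) :
    graphBasisChange ψ *ᵥ Pi.single i 1 = graphBasisVec ψ i := by
  ext x; simp [graphBasisChange]

theorem graphBasisVec_zero (ψ : QVec n) : graphBasisVec ψ 0 = ψ := by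
  simp [graphBasisVec]

theorem odd_add_of_ne {a b : Fin 2} (h : a ≠ b) : Odd ((a : ℕ) + (b : ℕ)) := by
  have : (a : ℕ) + (b : ℕ) = 1 := by omega
  rw [this]; exact odd_one

theorem graphBasisChange_mem_unitary {G : SimpleGraph (Fin n)} {ψ : QVec n}
    (h : IsGraphState G ψ) : graphBasisChange ψ ∈ Matrix.unitaryGroup (Bits n) ℂ := by
  rw [Matrix.mem_unitaryGroup_iff', Matrix.star_eq_conjTranspose]
  ext i j
  change star (graphBasisVec ψ i) ⬝ᵥ graphBasisVec ψ j = _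
  by_cases hij : i = j
  · subst hij
    rw [Matrix.one_apply_eq]
    exact graphBasisVec_unit h.1 i
  · rw [Matrix.one_apply_ne hij]
    obtain ⟨k, hk⟩ := Function.ne_iff.mp hij
    exact dotProduct_graphGen_eq_zero G k (graphGen_mulVec_graphBasisVec h.2 k i)
      (graphGen_mulVec_graphBasisVec h.2 k j) (odd_add_of_ne hk)

/-- The second graph state is orthogonal to every graph basis vector of the first with a nonzero
label, and the basis is complete. -/
theorem IsGraphState.eq_smul {G : SimpleGraph (Fin n)} {ψ φ : QVec n} (hψ : IsGraphState G ψ)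
    (hφ : IsGraphState G φ) : ∃ z : ℂ, ‖z‖ = 1 ∧ φ = z • ψ := by
  have h1 : (graphBasisChange ψ)ᴴ *ᵥ φ = (star ψ ⬝ᵥ φ) • Pi.single 0 1 := by
    ext i
    rw [conjTranspose_graphBasisChange_mulVec]
    by_cases hi : i = 0
    · subst hi
      simp [graphBasisVec_zero]
    · obtain ⟨k, hk⟩ := Function.ne_iff.mp hi
      rw [dotProduct_graphGen_eq_zero G k (b := 0) (graphGen_mulVec_graphBasisVec hψ.2 k i)
        (by simpa using hφ.2 k) (odd_add_of_ne hk)]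
      simp [hi]
  have h2 : φ = (star ψ ⬝ᵥ φ) • ψ := by
    have h3 := congrArg (graphBasisChange ψ *ᵥ ·) h1
    simp only [Matrix.mulVec_mulVec, Matrix.mulVec_smul, graphBasisChange_mulVec_single,
      graphBasisVec_zero] at h3
    rwa [← Matrix.star_eq_conjTranspose,
      Matrix.mem_unitaryGroup_iff.mp (graphBasisChange_mem_unitary hψ), Matrix.one_mulVec] at h3
  refine ⟨_, ?_, h2⟩
  have h4 := hφ.1
  rw [IsUnitVec] at h4
  set z := star ψ ⬝ᵥ φ
  have h5 : star ψ ⬝ᵥ ψ = 1 := hψ.1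
  rw [h2, star_smul, smul_dotProduct, dotProduct_smul, h5, smul_eq_mul, smul_eq_mul,
    mul_one, Complex.star_def, mul_comm, Complex.mul_conj, Complex.normSq_eq_norm_sq] at h4
  have h6 : ‖z‖ ^ 2 = 1 := by exact_mod_cast h4
  exact (pow_eq_one_iff_of_nonneg (norm_nonneg z) two_ne_zero).mp h6

/-- `Z_k` flips the label bit at `k`, and `(1 + U_k) / 2` keeps the result only if the new bit is
`0`. -/
theorem graphJump_mulVec_graphBasisVec {G : SimpleGraph (Fin n)} {ψ : QVec n}
    (h : ∀ k, graphGen G k *ᵥ ψ = ψ) (k : Fin n) (i : Bits n) :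
    graphJump G k *ᵥ graphBasisVec ψ i =
      if i k = 1 then graphBasisVec ψ (Function.update i k 0) else 0 := by
  have hz : siteOp k pauliZ *ᵥ graphBasisVec ψ i =
      graphBasisVec ψ (Function.update i k (1 - i k)) := by
    rw [graphBasisVec, Matrix.mulVec_mulVec, siteOp_pauliZ_mul_zOn]; rfl
  rw [graphJump, Matrix.smul_mulVec, ← Matrix.mulVec_mulVec, hz, Matrix.add_mulVec,
    Matrix.one_mulVec, graphGen_mulVec_graphBasisVec h]
  have : i k = 0 ∨ i k = 1 := by omega
  rcases this with h | h
  · simp [h]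
  · simp [h, ← two_smul ℂ, smul_smul]

theorem siteOp_sigmaMinus_mulVec_single (k : Fin n) (i : Bits n) :
    siteOp k sigmaMinus *ᵥ Pi.single i 1 =
      if i k = 1 then Pi.single (Function.update i k 0) 1 else 0 := by
  ext x
  rw [Matrix.mulVec_single_one, Matrix.col_apply, siteOp_apply]
  have hi : i k = 0 ∨ i k = 1 := by omega
  have hx : x k = 0 ∨ x k = 1 := by omega
  rcases hi with hi | hi
  · rcases hx with hx | hx <;> simp [hi, hx, sigmaMinus]
  · have hiff : Function.update x k 1 = i ∧ x k = 0 ↔ x = Function.update i k 0 := by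
      constructor
      · rintro ⟨rfl, h⟩
        rw [Function.update_idem, ← h, Function.update_eq_self]
      · rintro rfl
        rw [Function.update_idem, ← hi, Function.update_eq_self]
        simp
    rcases hx with hx | hx
    · simp only [hx, and_true] at hiff
      simp [hi, hx, sigmaMinus, Pi.single_apply, hiff]
    · simp only [hx, one_ne_zero, and_false, false_iff] at hiff
      simp [hi, hx, sigmaMinus, hiff]

theorem graphJump_eq {G : SimpleGraph (Fin n)} {ψ : QVec n} (h : IsGraphState G ψ) (k : Fin n) :
    graphJump G k = graphBasisChange ψ * siteOp k sigmaMinus * (graphBasisChange ψ)ᴴ := by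
  have h1 : graphJump G k * graphBasisChange ψ = graphBasisChange ψ * siteOp k sigmaMinus := by
    refine Matrix.ext_of_mulVec_single fun i => ?_
    rw [← Matrix.mulVec_mulVec, ← Matrix.mulVec_mulVec, graphBasisChange_mulVec_single,
      graphJump_mulVec_graphBasisVec h.2, siteOp_sigmaMinus_mulVec_single]
    split_ifs
    · rw [graphBasisChange_mulVec_single]
    · rw [Matrix.mulVec_zero]
  rw [← h1, mul_assoc, ← Matrix.star_eq_conjTranspose,
    Matrix.mem_unitaryGroup_iff.mp (graphBasisChange_mem_unitary h), mul_one]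

end GraphState

/-! ### Supports of operators via commutation. -/

section Locality

variable {n : ℕ}

theorem ActsOnlyOn.commute_siteOp {A : QOp n} {S : Finset (Fin n)} (h : ActsOnlyOn A S) {j : Fin n}
    (hj : j ∉ S) (P : Matrix (Fin 2) (Fin 2) ℂ) : Commute A (siteOp j P) := by
  obtain ⟨B, hB⟩ := h
  have hS : ∀ (x : Bits n) (b : Fin 2), (fun k : S => Function.update x j b k) = fun k : S => x k :=
    fun x b => funext fun k => Function.update_of_ne (fun hk : (k : Fin n) = j => hj (hk ▸ k.2)) _ _
  ext x y
  rw [mul_siteOp_apply, siteOp_mul_apply]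
  by_cases hxy : ∀ k, k ∉ S → k ≠ j → x k = y k
  · rw [Finset.sum_eq_single (x j), Finset.sum_eq_single (y j)]
    · rw [(hB x _).1, (hB _ y).1, hS, hS, mul_comm]
      · intro k hk
        by_cases hkj : k = j
        · subst hkj; simp
        · simp [hkj, hxy k hk hkj]
      · intro k hk
        by_cases hkj : k = j
        · subst hkj; simp
        · simp [hkj, hxy k hk hkj]
    · intro b _ hb
      rw [(hB _ y).2 ⟨j, hj, by simpa using hb⟩, mul_zero]
    · simp
    · intro b _ hb
      rw [(hB x _).2 ⟨j, hj, by simpa using hb.symm⟩, zero_mul]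
    · simp
  · push Not at hxy
    obtain ⟨k, hk, hkj, hne⟩ := hxy
    rw [Finset.sum_eq_zero, Finset.sum_eq_zero]
    · intro b _
      rw [(hB _ y).2 ⟨k, hk, by simpa [hkj] using hne⟩, mul_zero]
    · intro b _
      rw [(hB x _).2 ⟨k, hk, by simpa [hkj] using hne⟩, zero_mul]

/-- For the converse, commuting with the matrix units at a site `j` off `S` says that entries vanish
unless `x j = y j` and do not depend on this common bit. -/
theorem actsOnlyOn_iff_commute {A : QOp n} {S : Finset (Fin n)} :
    ActsOnlyOn A S ↔ ∀ j ∉ S, ∀ P, Commute A (siteOp j P) := by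
  classical
  refine ⟨fun h j hj P => h.commute_siteOp hj P, fun h => ?_⟩
  have key : ∀ j ∉ S, ∀ (x y : Bits n) (a b : Fin 2),
      (if b = y j then A x (Function.update y j a) else 0) =
        if x j = a then A (Function.update x j b) y else 0 := by
    intro j hj x y a b
    have := congrFun (congrFun (h j hj (Matrix.single a b 1)).eq x) y
    rw [mul_siteOp_apply, siteOp_mul_apply] at this
    simpa [Matrix.single_apply, ite_and, eq_comm] using this
  have hzero : ∀ j ∉ S, ∀ x y : Bits n, x j ≠ y j → A x y = 0 := by
    intro j hj x y hxy
    simpa [hxy] using key j hj x y (y j) (y j)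
  have hupd : ∀ j ∉ S, ∀ x y : Bits n, x j = y j → ∀ b,
      A (Function.update x j b) (Function.update y j b) = A x y := by
    intro j hj x y hxy b
    have := key j hj x (Function.update y j b) (x j) b
    rw [if_pos (by simp), if_pos rfl, Function.update_idem, hxy, Function.update_eq_self] at this
    exact this.symm
  -- Bits outside `S` are reset to `0` one site at a time, so that entries depend only on the
  -- restrictions to `S`.
  have hclear : ∀ T : Finset (Fin n), Disjoint T S → ∀ x y : Bits n, (∀ k ∉ S, x k = y k) →
      A x y = A (fun k => if k ∈ T then 0 else x k) (fun k => if k ∈ T then 0 else y k) := by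
    intro T
    induction T using Finset.induction_on with
    | empty => intro _ x y _; simp
    | insert j T hj ih =>
      intro hT x y hxy
      rw [Finset.disjoint_insert_left] at hT
      rw [ih hT.2 x y hxy, ← hupd j hT.1 _ _ (by simp [hj, hxy j hT.1]) 0]
      congr 1 <;> ext1 k <;> by_cases hk : k = j
      · subst hk; simp
      · simp [hk]
      · subst hk; simp
      · simp [hk]
  let ext (u : S → Fin 2) : Bits n := fun k => if hk : k ∈ S then u ⟨k, hk⟩ else 0
  refine ⟨Matrix.of fun u v => A (ext u) (ext v), fun x y => ⟨fun hxy => ?_, ?_⟩⟩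
  · rw [hclear Sᶜ disjoint_compl_left x y hxy, Matrix.of_apply]
    congr 1 <;> ext1 k <;> by_cases hk : k ∈ S <;> simp [ext, hk]
  · rintro ⟨k, hk, hne⟩
    exact hzero k hk x y hne

theorem actsOnlyOn_tensorOp_conj {V : Fin n → Matrix (Fin 2) (Fin 2) ℂ}
    (hV : ∀ k, V k ∈ Matrix.unitaryGroup (Fin 2) ℂ) (A : QOp n) (S : Finset (Fin n)) :
    ActsOnlyOn (tensorOp V * A * (tensorOp V)ᴴ) S ↔ ActsOnlyOn A S := by
  have h1 : (tensorOp V)ᴴ * tensorOp V = 1 :=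
    Matrix.mem_unitaryGroup_iff'.mp (tensorOp_mem_unitary hV)
  have h2 : tensorOp V * (tensorOp V)ᴴ = 1 :=
    Matrix.mem_unitaryGroup_iff.mp (tensorOp_mem_unitary hV)
  have aux : ∀ {V : Fin n → Matrix (Fin 2) (Fin 2) ℂ},
      (∀ k, V k ∈ Matrix.unitaryGroup (Fin 2) ℂ) → ∀ A : QOp n,
      ActsOnlyOn A S → ActsOnlyOn (tensorOp V * A * (tensorOp V)ᴴ) S := by
    intro V hV A hA
    have h1 : (tensorOp V)ᴴ * tensorOp V = 1 :=
      Matrix.mem_unitaryGroup_iff'.mp (tensorOp_mem_unitary hV)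
    have h2 : tensorOp V * (tensorOp V)ᴴ = 1 :=
      Matrix.mem_unitaryGroup_iff.mp (tensorOp_mem_unitary hV)
    rw [actsOnlyOn_iff_commute] at hA ⊢
    intro j hj P
    have hc := (hA j hj ((V j)ᴴ * P * V j)).eq
    rw [← tensorOp_mul_siteOp_mul hV] at hc
    rw [commute_iff_eq]
    calc tensorOp V * A * (tensorOp V)ᴴ * siteOp j P
        = tensorOp V * A * (tensorOp V)ᴴ * siteOp j P * (tensorOp V * (tensorOp V)ᴴ) := by
          rw [h2, mul_one]
      _ = tensorOp V * (A * ((tensorOp V)ᴴ * siteOp j P * tensorOp V)) * (tensorOp V)ᴴ := by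
          simp only [mul_assoc]
      _ = (tensorOp V * (tensorOp V)ᴴ) * siteOp j P * (tensorOp V * A * (tensorOp V)ᴴ) := by
          rw [hc]; simp only [mul_assoc]
      _ = siteOp j P * (tensorOp V * A * (tensorOp V)ᴴ) := by rw [h2, one_mul]
  refine ⟨fun h => ?_, aux hV A⟩
  have hV' : ∀ k, (V k)ᴴ ∈ Matrix.unitaryGroup (Fin 2) ℂ := fun k =>
    Unitary.star_mem (hV k)
  have := aux hV' _ h
  rw [← tensorOp_conjTranspose, Matrix.conjTranspose_conjTranspose] at this
  convert this using 1
  calc A = ((tensorOp V)ᴴ * tensorOp V) * A * ((tensorOp V)ᴴ * tensorOp V) := by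
        rw [h1, one_mul, mul_one]
    _ = _ := by simp only [mul_assoc]

theorem not_commute_of_anticommute {A B : QOp n} (hA : A * A = 1) (hB : B * B = 1)
    (h : A * B = (-1 : ℂ) • (B * A)) : ¬ Commute A B := by
  intro hc
  have h1 : (2 : ℂ) • (B * A) = 0 := by
    rw [hc.eq] at h
    rw [two_smul]
    nth_rewrite 1 [h]
    simp
  have h2 : B * A = 0 := by simpa using h1
  have h3 : (1 : QOp n) = 0 := by
    calc (1 : QOp n) = B * (B * A) * A := by rw [← mul_assoc, hB, one_mul, hA]
      _ = 0 := by rw [h2]; simp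
  exact one_ne_zero h3

/-- `Z_k` detects the factor `X` at `k`, just as `X_j` detects the factor `Z` at a neighbour `j`;
this makes the support of the generator exact. -/
theorem not_commute_graphGen_pauliZ (G : SimpleGraph (Fin n)) (k : Fin n) :
    ¬ Commute (graphGen G k) (siteOp k pauliZ) := by
  refine not_commute_of_anticommute (graphGen_mul_self G k) ?_ ?_
  · rw [siteOp_mul, pauliZ_mul_self, siteOp_one]
  · rw [siteOp_pauliZ_eq_zOn, graphGen_mul_zOn]
    simp

theorem not_commute_graphGen_pauliX {G : SimpleGraph (Fin n)} {k j : Fin n} (h : G.Adj k j) :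
    ¬ Commute (graphGen G k) (siteOp j pauliX) := by
  refine not_commute_of_anticommute (graphGen_mul_self G k) ?_ ?_
  · rw [siteOp_mul, pauliX_mul_self, siteOp_one]
  · rw [siteOp_eq_tensorOp, graphGen_eq, tensorOp_mul_eq_smul
      (ε := fun l => if l = j then (-1 : ℂ) else 1)]
    · simp
    · intro l
      by_cases hl : l = j
      · subst hl
        simpa [graphFactor, h.ne', h] using pauliZ_mul_pauliX
      · simp [hl]

theorem commute_graphGen_siteOp {G : SimpleGraph (Fin n)} {k j : Fin n} (hjk : j ≠ k)
    (h : ¬ G.Adj k j) (P : Matrix (Fin 2) (Fin 2) ℂ) : Commute (graphGen G k) (siteOp j P) := by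
  rw [commute_iff_eq, siteOp_eq_tensorOp, graphGen_eq, tensorOp_mul, tensorOp_mul]
  congr 1
  ext1 l
  by_cases hl : l = j
  · subst hl
    simp [graphFactor, hjk, h]
  · simp [hl]

theorem actsOnlyOn_graphGen_iff (G : SimpleGraph (Fin n)) (k : Fin n) (S : Finset (Fin n)) :
    ActsOnlyOn (graphGen G k) S ↔ insert k (G.neighborSet k) ⊆ (S : Set (Fin n)) := by
  rw [actsOnlyOn_iff_commute]
  constructor
  · rintro h j (rfl | hj)
    · by_contra hS
      exact not_commute_graphGen_pauliZ G j (h j hS _)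
    · by_contra hS
      exact not_commute_graphGen_pauliX hj (h j hS _)
  · intro h j hj P
    refine commute_graphGen_siteOp ?_ ?_ P
    · rintro rfl
      exact hj (h (Set.mem_insert _ _))
    · intro ha
      exact hj (h (Set.mem_insert_of_mem _ ha))

/-- An operator that commutes with `Z_k` commutes with the jump operator at `k` if and only if it
commutes with the generator at `k`. -/
theorem commute_graphJump_iff (G : SimpleGraph (Fin n)) {k : Fin n} {B : QOp n}
    (hB : Commute (siteOp k pauliZ) B) : Commute (graphJump G k) B ↔ Commute (graphGen G k) B := by
  have hZ : siteOp k pauliZ * siteOp k pauliZ = 1 := by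
    rw [siteOp_mul, pauliZ_mul_self, siteOp_one]
  constructor
  · intro h
    -- Since `Z_k² = 1`, the generator is recovered from the jump operator as `2 c_k Z_k - 1`.
    have h1 : graphGen G k = (2 : ℂ) • (graphJump G k * siteOp k pauliZ) - 1 := by
      rw [graphJump, smul_mul_assoc, mul_assoc, hZ, mul_one, smul_smul]
      norm_num
    rw [h1]
    exact ((h.mul_left hB).smul_left _).sub_left (Commute.one_left B)
  · intro h
    exact (((Commute.one_left B).add_left h).mul_left hB).smul_left _

theorem actsOnlyOn_graphJump_iff (G : SimpleGraph (Fin n)) (k : Fin n) (S : Finset (Fin n)) :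
    ActsOnlyOn (graphJump G k) S ↔ insert k (G.neighborSet k) ⊆ (S : Set (Fin n)) := by
  rw [← actsOnlyOn_graphGen_iff, actsOnlyOn_iff_commute, actsOnlyOn_iff_commute]
  by_cases hk : k ∈ S
  · refine forall_congr' fun j => forall_congr' fun hj => forall_congr' fun P =>
      commute_graphJump_iff G (commute_siteOp ?_ _ _)
    rintro rfl
    exact hj hk
  -- If `k ∉ S`, both sides are false: neither operator commutes with `Z_k`.
  · constructor
    · intro h
      exact absurd ((commute_graphJump_iff G (Commute.refl _)).mp (h k hk pauliZ))
        (not_commute_graphGen_pauliZ G k)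
    · intro h
      exact absurd (h k hk pauliZ) (not_commute_graphGen_pauliZ G k)

theorem IsQuasiLocal.of_actsOnlyOn {d : Fin n → Fin n → ℝ} {R : ℝ} {r : ℕ} {A B : Fin n → QOp n}
    (h : IsQuasiLocal d R r A) (hAB : ∀ k S, ActsOnlyOn (A k) S → ActsOnlyOn (B k) S) :
    IsQuasiLocal d R r B := fun k => by
  obtain ⟨S, h1, h2, h3⟩ := h k
  exact ⟨S, h1, h2, hAB k S h3⟩

end Locality

/-! ### One-qubit Pauli group and Clifford operators. -/

section Clifford

theorem pauliX_mul_pauliY : pauliX * pauliY = Complex.I • pauliZ := by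
  ext i j; fin_cases i <;> fin_cases j <;> simp [pauliX, pauliY, pauliZ, Matrix.mul_apply]

theorem pauliY_mul_pauliX : pauliY * pauliX = (-Complex.I) • pauliZ := by
  ext i j; fin_cases i <;> fin_cases j <;> simp [pauliX, pauliY, pauliZ, Matrix.mul_apply]

theorem pauliY_mul_pauliZ : pauliY * pauliZ = Complex.I • pauliX := by
  ext i j; fin_cases i <;> fin_cases j <;> simp [pauliX, pauliY, pauliZ, Matrix.mul_apply]

theorem pauliZ_mul_pauliY : pauliZ * pauliY = (-Complex.I) • pauliX := by
  ext i j; fin_cases i <;> fin_cases j <;> simp [pauliX, pauliY, pauliZ, Matrix.mul_apply]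

theorem pauliZ_mul_pauliX_eq : pauliZ * pauliX = Complex.I • pauliY := by
  ext i j; fin_cases i <;> fin_cases j <;> simp [pauliX, pauliY, pauliZ, Matrix.mul_apply]

theorem pauliX_mul_pauliZ_eq : pauliX * pauliZ = (-Complex.I) • pauliY := by
  ext i j; fin_cases i <;> fin_cases j <;> simp [pauliX, pauliY, pauliZ, Matrix.mul_apply]

/-- The matrices `1, X, Y, Z`. -/
def IsPauliMatrix (P : Matrix (Fin 2) (Fin 2) ℂ) : Prop :=
  P = 1 ∨ P = pauliX ∨ P = pauliY ∨ P = pauliZ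

theorem IsPauliMatrix.one : IsPauliMatrix 1 := Or.inl rfl

theorem IsPauliMatrix.pauliX : IsPauliMatrix pauliX := Or.inr (Or.inl rfl)

theorem IsPauliMatrix.pauliY : IsPauliMatrix pauliY := Or.inr (Or.inr (Or.inl rfl))

theorem IsPauliMatrix.pauliZ : IsPauliMatrix pauliZ := Or.inr (Or.inr (Or.inr rfl))

theorem IsPauliMatrix.mul_self {P : Matrix (Fin 2) (Fin 2) ℂ} (h : IsPauliMatrix P) :
    P * P = 1 := by
  rcases h with rfl | rfl | rfl | rfl
  exacts [one_mul 1, pauliX_mul_self, pauliY_mul_self, pauliZ_mul_self]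

theorem IsPauliMatrix.smul_mem {P : Matrix (Fin 2) (Fin 2) ℂ} (h : IsPauliMatrix P) {ω : ℂ}
    (hω : ω ^ 4 = 1) : ω • P ∈ pauliGroupOne := ⟨ω, P, hω, h, rfl⟩

theorem IsPauliMatrix.mem {P : Matrix (Fin 2) (Fin 2) ℂ} (h : IsPauliMatrix P) :
    P ∈ pauliGroupOne := ⟨1, P, one_pow 4, h, (one_smul ℂ P).symm⟩

theorem smul_mem_pauliGroupOne {Q : Matrix (Fin 2) (Fin 2) ℂ} (h : Q ∈ pauliGroupOne) {ω : ℂ}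
    (hω : ω ^ 4 = 1) : ω • Q ∈ pauliGroupOne := by
  obtain ⟨z, P, hz, hP, rfl⟩ := h
  exact ⟨ω * z, P, by rw [mul_pow, hω, hz, one_mul], hP, smul_smul ω z P⟩

theorem mul_mem_pauliGroupOne {Q Q' : Matrix (Fin 2) (Fin 2) ℂ} (h : Q ∈ pauliGroupOne)
    (h' : Q' ∈ pauliGroupOne) : Q * Q' ∈ pauliGroupOne := by
  obtain ⟨z, P, hz, hP, rfl⟩ := h
  obtain ⟨z', P', hz', hP', rfl⟩ := h'
  have hI : (-Complex.I) ^ 4 = 1 := by rw [neg_pow, Complex.I_pow_four]; norm_num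
  rw [smul_mul_smul_comm]
  refine smul_mem_pauliGroupOne ?_ (by rw [mul_pow, hz, hz', one_mul])
  rcases hP with rfl | rfl | rfl | rfl
  · rw [one_mul]; exact IsPauliMatrix.mem hP'
  all_goals rcases hP' with rfl | rfl | rfl | rfl
  · rw [mul_one]; exact IsPauliMatrix.pauliX.mem
  · rw [pauliX_mul_self]; exact IsPauliMatrix.one.mem
  · rw [pauliX_mul_pauliY]; exact IsPauliMatrix.pauliZ.smul_mem Complex.I_pow_four
  · rw [pauliX_mul_pauliZ_eq]; exact IsPauliMatrix.pauliY.smul_mem hI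
  · rw [mul_one]; exact IsPauliMatrix.pauliY.mem
  · rw [pauliY_mul_pauliX]; exact IsPauliMatrix.pauliZ.smul_mem hI
  · rw [pauliY_mul_self]; exact IsPauliMatrix.one.mem
  · rw [pauliY_mul_pauliZ]; exact IsPauliMatrix.pauliX.smul_mem Complex.I_pow_four
  · rw [mul_one]; exact IsPauliMatrix.pauliZ.mem
  · rw [pauliZ_mul_pauliX_eq]; exact IsPauliMatrix.pauliY.smul_mem Complex.I_pow_four
  · rw [pauliZ_mul_pauliY]; exact IsPauliMatrix.pauliX.smul_mem hI
  · rw [pauliZ_mul_self]; exact IsPauliMatrix.one.mem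

/-- `X` and `Z` suffice because `Y = -i Z X`. -/
theorem isCliffordOne_of_conj_mem {W : Matrix (Fin 2) (Fin 2) ℂ}
    (hW : W ∈ Matrix.unitaryGroup (Fin 2) ℂ) (hX : W * pauliX * Wᴴ ∈ pauliGroupOne)
    (hZ : W * pauliZ * Wᴴ ∈ pauliGroupOne) : IsCliffordOne W := by
  have h1 : Wᴴ * W = 1 := Matrix.mem_unitaryGroup_iff'.mp hW
  have h2 : W * Wᴴ = 1 := Matrix.mem_unitaryGroup_iff.mp hW
  refine ⟨hW, ?_⟩
  rintro _ ⟨ω, P, hω, hP, rfl⟩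
  rw [mul_smul_comm, smul_mul_assoc]
  refine smul_mem_pauliGroupOne ?_ hω
  rcases hP with rfl | rfl | rfl | rfl
  · rw [mul_one, h2]; exact IsPauliMatrix.one.mem
  · exact hX
  · have hY : pauliY = (-Complex.I) • (pauliZ * pauliX) := by
      rw [pauliZ_mul_pauliX_eq, smul_smul]; simp
    have hI : (-Complex.I) ^ 4 = 1 := by rw [neg_pow, Complex.I_pow_four]; norm_num
    have : W * pauliY * Wᴴ =
        (-Complex.I) • ((W * pauliZ * Wᴴ) * (W * pauliX * Wᴴ)) := by
      rw [hY, mul_smul_comm, smul_mul_assoc]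
      congr 1
      calc W * (pauliZ * pauliX) * Wᴴ = W * pauliZ * 1 * pauliX * Wᴴ := by
            simp only [mul_assoc, one_mul]
        _ = _ := by rw [← h1]; simp only [mul_assoc]
    rw [this]
    exact smul_mem_pauliGroupOne (mul_mem_pauliGroupOne hZ hX) hI
  · exact hZ

theorem isCliffordOne_one : IsCliffordOne 1 :=
  ⟨one_mem _, fun P hP => by simpa using hP⟩

theorem IsCliffordOne.mul {W W' : Matrix (Fin 2) (Fin 2) ℂ} (h : IsCliffordOne W)
    (h' : IsCliffordOne W') : IsCliffordOne (W * W') := by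
  refine ⟨mul_mem h.1 h'.1, fun P hP => ?_⟩
  have := h.2 _ (h'.2 P hP)
  simpa only [Matrix.conjTranspose_mul, mul_assoc] using this

/-- The Hadamard matrix. -/
noncomputable def hadamard : Matrix (Fin 2) (Fin 2) ℂ :=
  ((Real.sqrt 2)⁻¹ : ℂ) • !![1, 1; 1, -1]

theorem hadamard_conjTranspose : hadamardᴴ = hadamard := by
  ext i j; fin_cases i <;> fin_cases j <;> simp [hadamard]

theorem hadamard_mul_self : hadamard * hadamard = 1 := by
  have h : ((Real.sqrt 2 : ℂ))⁻¹ * ((Real.sqrt 2 : ℂ))⁻¹ = 2⁻¹ := by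
    rw [← mul_inv]
    norm_cast
    rw [Real.mul_self_sqrt (by norm_num)]
    norm_num
  rw [hadamard, smul_mul_smul_comm, h]
  ext i j; fin_cases i <;> fin_cases j <;> norm_num [Matrix.mul_apply, Matrix.one_apply]

theorem pauliZ_mul_hadamard : pauliZ * hadamard = hadamard * pauliX := by
  ext i j; fin_cases i <;> fin_cases j <;> simp [hadamard, pauliX, pauliZ, Matrix.mul_apply]

theorem hadamard_mul_pauliZ : hadamard * pauliZ = pauliX * hadamard := by
  ext i j; fin_cases i <;> fin_cases j <;> simp [hadamard, pauliX, pauliZ, Matrix.mul_apply]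

theorem isCliffordOne_hadamard : IsCliffordOne hadamard := by
  refine isCliffordOne_of_conj_mem ?_ ?_ ?_
  · rw [Matrix.mem_unitaryGroup_iff, Matrix.star_eq_conjTranspose, hadamard_conjTranspose,
      hadamard_mul_self]
  · rw [hadamard_conjTranspose, ← pauliZ_mul_hadamard, mul_assoc, hadamard_mul_self, mul_one]
    exact IsPauliMatrix.pauliZ.mem
  · rw [hadamard_conjTranspose, hadamard_mul_pauliZ, mul_assoc, hadamard_mul_self, mul_one]
    exact IsPauliMatrix.pauliX.mem

/-- A diagonal Clifford operator takes `X` to `±X` or `±Y`. -/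
theorem exists_clifford_conj_pauliX {P : Matrix (Fin 2) (Fin 2) ℂ} (hP : P = pauliX ∨ P = pauliY)
    {ω : ℂ} (hω : ω = 1 ∨ ω = -1) :
    ∃ W, IsCliffordOne W ∧ W * pauliX * Wᴴ = ω • P ∧ W * pauliZ * Wᴴ = pauliZ := by
  -- Conjugation by `diag(1, u)` puts `u` and its conjugate off the diagonal of `X`: `u = ±1` gives
  -- `±X` and `u = ±i` gives `±Y`.
  obtain ⟨u, hu, huP⟩ : ∃ u : ℂ, u * star u = 1 ∧ !![0, star u; u, 0] = ω • P := by
    rcases hP with rfl | rfl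
    · refine ⟨ω, ?_, ?_⟩ <;> rcases hω with rfl | rfl <;> simp [pauliX]
    · refine ⟨ω * Complex.I, ?_, ?_⟩ <;> rcases hω with rfl | rfl <;> simp [pauliY]
  have hX : !![1, 0; 0, u] * pauliX * !![1, 0; 0, u]ᴴ = ω • P := by
    rw [← huP]
    ext i j; fin_cases i <;> fin_cases j <;> simp [pauliX, Matrix.mul_apply]
  have hZ : !![1, 0; 0, u] * pauliZ * !![1, 0; 0, u]ᴴ = pauliZ := by
    simp only [Complex.star_def] at hu
    ext i j; fin_cases i <;> fin_cases j <;> simp [pauliZ, Matrix.mul_apply, hu]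
  refine ⟨!![1, 0; 0, u], isCliffordOne_of_conj_mem ?_ ?_ ?_, hX, hZ⟩
  · rw [Matrix.mem_unitaryGroup_iff, Matrix.star_eq_conjTranspose]
    simp only [Complex.star_def] at hu
    ext i j; fin_cases i <;> fin_cases j <;> simp [Matrix.mul_apply, hu]
  · rw [hX]
    refine ⟨ω, P, ?_, ?_, rfl⟩
    · rcases hω with rfl | rfl <;> norm_num
    · rcases hP with rfl | rfl
      exacts [IsPauliMatrix.pauliX, IsPauliMatrix.pauliY]
  · rw [hZ]
    exact IsPauliMatrix.pauliZ.mem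

end Clifford

/-! ### Stabilizers under local Clifford operators. -/

section PauliGroup

variable {n : ℕ}

theorem smul_tensorOp_mem_pauliGroup {ω : ℂ} (hω : ω ^ 4 = 1)
    {Q : Fin n → Matrix (Fin 2) (Fin 2) ℂ} (hQ : ∀ k, Q k ∈ pauliGroupOne) :
    ω • tensorOp Q ∈ pauliGroup n := by
  choose z P hz hP h using hQ
  obtain rfl : Q = fun k => z k • P k := funext h
  refine ⟨ω * ∏ k, z k, P, ?_, hP, ?_⟩
  · rw [mul_pow, hω, ← Finset.prod_pow]
    simp [hz]
  · rw [tensorOp_smul, smul_smul]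

theorem tensorOp_conj_mem_pauliStabilizer {V : Fin n → Matrix (Fin 2) (Fin 2) ℂ}
    (hV : ∀ k, IsCliffordOne (V k)) {ψ : QVec n} {A : QOp n} (hA : A ∈ pauliStabilizer ψ) :
    tensorOp V * A * (tensorOp V)ᴴ ∈ pauliStabilizer (tensorOp V *ᵥ ψ) := by
  have h1 : (tensorOp V)ᴴ * tensorOp V = 1 :=
    Matrix.mem_unitaryGroup_iff'.mp (tensorOp_mem_unitary fun k => (hV k).1)
  obtain ⟨⟨ω, P, hω, hP, rfl⟩, h⟩ := hA
  constructor
  · rw [mul_smul_comm, smul_mul_assoc, tensorOp_conjTranspose, tensorOp_mul, tensorOp_mul]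
    exact smul_tensorOp_mem_pauliGroup hω fun k => (hV k).2 _ (IsPauliMatrix.mem (hP k))
  · rw [Matrix.mulVec_mulVec, mul_assoc, h1, mul_one, ← Matrix.mulVec_mulVec, h]

theorem graphGen_mem_pauliStabilizer {G : SimpleGraph (Fin n)} {φ : QVec n}
    (h : IsGraphState G φ) (k : Fin n) : graphGen G k ∈ pauliStabilizer φ := by
  refine ⟨⟨1, graphFactor G k, one_pow 4, fun j => ?_, ?_⟩, h.2 k⟩
  · unfold graphFactor
    split_ifs
    exacts [IsPauliMatrix.pauliX, IsPauliMatrix.pauliZ, IsPauliMatrix.one]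
  · rw [graphGen_eq, one_smul]

theorem IsUnitVec.ne_zero {ψ : QVec n} (h : IsUnitVec ψ) : ψ ≠ 0 := by
  rintro rfl
  simp [IsUnitVec] at h

/-- Conjugation carries the stabilizer of `ψ` into that of the image, so a vector fixed by the
latter pulls back to one fixed by the former. -/
theorem IsStabilizerState.tensorOp_mulVec {V : Fin n → Matrix (Fin 2) (Fin 2) ℂ}
    (hV : ∀ k, IsCliffordOne (V k)) {ψ : QVec n} (h : IsStabilizerState ψ) :
    IsStabilizerState (tensorOp V *ᵥ ψ) := by
  have h1 : (tensorOp V)ᴴ * tensorOp V = 1 :=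
    Matrix.mem_unitaryGroup_iff'.mp (tensorOp_mem_unitary fun k => (hV k).1)
  have h2 : tensorOp V * (tensorOp V)ᴴ = 1 :=
    Matrix.mem_unitaryGroup_iff.mp (tensorOp_mem_unitary fun k => (hV k).1)
  refine ⟨(dotProduct_mulVec_unitary h1 ψ ψ).trans h.1, fun φ hφ => ?_⟩
  obtain ⟨z, hz⟩ := h.2 ((tensorOp V)ᴴ *ᵥ φ) fun A hA => by
    have := congrArg ((tensorOp V)ᴴ *ᵥ ·) (hφ _ (tensorOp_conj_mem_pauliStabilizer hV hA))
    simpa only [Matrix.mulVec_mulVec, ← mul_assoc, h1, one_mul] using this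
  refine ⟨z, ?_⟩
  rw [← Matrix.mulVec_smul, ← hz, Matrix.mulVec_mulVec, h2, Matrix.one_mulVec]

/-- Anticommuting involutions have no common eigenvector. -/
theorem eq_zero_of_anticommute {A B : QOp n} {ψ : QVec n} {a b : ℂ} (hA : A * A = 1)
    (hB : B * B = 1) (h : A * B = (-1 : ℂ) • (B * A)) (ha : A *ᵥ ψ = a • ψ)
    (hb : B *ᵥ ψ = b • ψ) : ψ = 0 := by
  have h1 : (A * B) *ᵥ ψ = (a * b) • ψ := by
    rw [← Matrix.mulVec_mulVec, hb, Matrix.mulVec_smul, ha, smul_smul, mul_comm]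
  have h2 : (B * A) *ᵥ ψ = (a * b) • ψ := by
    rw [← Matrix.mulVec_mulVec, ha, Matrix.mulVec_smul, hb, smul_smul]
  have h3 : (a * b) • ψ = 0 := by
    rw [h, Matrix.smul_mulVec, h2, neg_one_smul] at h1
    exact self_eq_neg.mp h1.symm
  calc ψ = (A * (B * B) * A) *ᵥ ψ := by rw [hB, mul_one, hA, Matrix.one_mulVec]
    _ = (A * B) *ᵥ ((B * A) *ᵥ ψ) := by rw [Matrix.mulVec_mulVec]; simp only [mul_assoc]
    _ = 0 := by rw [h2, h3, Matrix.mulVec_zero]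

end PauliGroup

/-! ### Removing stabilizing `Z` products with Hadamards. -/

section Hadamards

variable {n : ℕ}

/-- The sets `S` for which the vector is an eigenvector of `Z_S`. -/
def zLabels (ψ : QVec n) : Set (Set (Fin n)) := {S | ∃ w : ℂ, zOn S *ᵥ ψ = w • ψ}

/-- Pulling `Z_T` back through the Hadamard gives `B`, with `X` at `k` if `k ∈ T`. In that case `B`
anticommutes with `Z_S`, which excludes a common eigenvector; hence `k ∉ T` and `B = Z_T`. So no
label is gained and `S` is lost. -/
theorem zLabels_hadamard_ssubset {ψ : QVec n} (hψ : ψ ≠ 0) {S : Set (Fin n)} (hS : S ∈ zLabels ψ)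
    {k : Fin n} (hk : k ∈ S) : zLabels (siteOp k hadamard *ᵥ ψ) ⊂ zLabels ψ := by
  classical
  have hH : siteOp k hadamard * siteOp k hadamard = 1 := by
    rw [siteOp_mul, hadamard_mul_self, siteOp_one]
  have key : ∀ T ∈ zLabels (siteOp k hadamard *ᵥ ψ), k ∉ T ∧ T ∈ zLabels ψ := by
    rintro T ⟨w, hw⟩
    let B : QOp n := tensorOp fun j => if j = k ∧ k ∈ T then pauliX else if j ∈ T then pauliZ else 1
    have hB : zOn T * siteOp k hadamard = siteOp k hadamard * B := by
      rw [zOn, siteOp_eq_tensorOp, tensorOp_mul, tensorOp_mul]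
      congr 1
      ext1 j
      by_cases hj : j = k
      · subst hj
        by_cases hT : j ∈ T <;> simp [hT, pauliZ_mul_hadamard]
      · simp [hj]
    have hBψ : B *ᵥ ψ = w • ψ := by
      rw [Matrix.mulVec_mulVec, hB] at hw
      have := congrArg (siteOp k hadamard *ᵥ ·) hw
      simpa only [Matrix.mulVec_smul, Matrix.mulVec_mulVec, ← mul_assoc, hH, one_mul,
        Matrix.one_mulVec] using this
    by_cases hT : k ∈ T
    · exfalso
      obtain ⟨w', hw'⟩ := hS
      refine hψ (eq_zero_of_anticommute (A := B) ?_ (zOn_mul_zOn_self S) ?_ hBψ hw')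
      · have : ∀ P Q : Prop, ∀ [Decidable P] [Decidable Q],
            (if P then pauliX else if Q then pauliZ else 1) *
              (if P then pauliX else if Q then pauliZ else 1) = 1 := by
          intro P Q _ _
          split_ifs
          exacts [pauliX_mul_self, pauliZ_mul_self, one_mul 1]
        rw [tensorOp_mul]
        simp only [this, tensorOp_one]
      · rw [zOn, tensorOp_mul_eq_smul (ε := fun j => if j = k then (-1 : ℂ) else 1)]
        · simp [B]
        · intro j
          by_cases hj : j = k
          · subst hj
            simpa [hT, hk] using pauliX_mul_pauliZ
          · by_cases hjS : j ∈ S <;> by_cases hjT : j ∈ T <;> simp [hj, hjS, hjT]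
    · refine ⟨hT, w, ?_⟩
      have : B = zOn T := by simp [B, zOn, hT]
      rwa [← this]
  refine ⟨fun T hT => (key T hT).2, fun hsub => (key S (hsub hS)).1 hk⟩

end Hadamards

/-! ### Reduction of stabilizer states to graph states by duality over `ZMod 2`. -/

section StandardForm

variable {n : ℕ}

/-- The sign `(-1) ^ a`. -/
def zmodSign (a : ZMod 2) : ℂ := (-1) ^ a.val

@[simp]
theorem zmodSign_zero : zmodSign 0 = 1 := by simp [zmodSign]

@[simp]
theorem zmodSign_one : zmodSign 1 = -1 := by simp [zmodSign, ZMod.val_one]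

theorem zmod_two_cases (a : ZMod 2) : a = 0 ∨ a = 1 := by
  fin_cases a
  exacts [Or.inl rfl, Or.inr rfl]

theorem zmodSign_add (a b : ZMod 2) : zmodSign (a + b) = zmodSign a * zmodSign b := by
  have h : (1 + 1 : ZMod 2) = 0 := rfl
  rcases zmod_two_cases a with rfl | rfl <;> rcases zmod_two_cases b with rfl | rfl <;> simp [h]

theorem zmodSign_sum {ι : Type*} (s : Finset ι) (f : ι → ZMod 2) :
    zmodSign (∑ i ∈ s, f i) = ∏ i ∈ s, zmodSign (f i) := by
  classical
  induction s using Finset.induction_on with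
  | empty => simp
  | insert i s hi ih => rw [Finset.sum_insert hi, Finset.prod_insert hi, zmodSign_add, ih]

/-- `a` tells whether the matrix commutes or anticommutes with `Z`: the `X` part of a Pauli matrix. -/
def HasXPart (Q : Matrix (Fin 2) (Fin 2) ℂ) (a : ZMod 2) : Prop :=
  Q * pauliZ = zmodSign a • (pauliZ * Q)

theorem HasXPart.mul {Q Q' : Matrix (Fin 2) (Fin 2) ℂ} {a a' : ZMod 2} (h : HasXPart Q a)
    (h' : HasXPart Q' a') : HasXPart (Q * Q') (a + a') := by
  rw [HasXPart] at h h' ⊢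
  rw [mul_assoc, h', mul_smul_comm, ← mul_assoc, h, smul_mul_assoc, smul_smul, zmodSign_add,
    mul_comm (zmodSign a), mul_assoc]

theorem IsPauliMatrix.exists_hasXPart {P : Matrix (Fin 2) (Fin 2) ℂ} (h : IsPauliMatrix P) :
    ∃ a, HasXPart P a := by
  rcases h with rfl | rfl | rfl | rfl
  · exact ⟨0, by simp [HasXPart]⟩
  · exact ⟨1, by rw [HasXPart, zmodSign_one, pauliX_mul_pauliZ]⟩
  · exact ⟨1, by rw [HasXPart, zmodSign_one, pauliY_mul_pauliZ, pauliZ_mul_pauliY, smul_smul]; simp⟩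
  · exact ⟨0, by simp [HasXPart]⟩

theorem IsPauliMatrix.eq_of_hasXPart_zero {P : Matrix (Fin 2) (Fin 2) ℂ} (h : IsPauliMatrix P)
    (h0 : HasXPart P 0) : P = 1 ∨ P = _root_.pauliZ := by
  have h1 := congrFun (congrFun h0 0) 1
  rcases h with rfl | rfl | rfl | rfl
  · exact Or.inl rfl
  · norm_num [_root_.pauliX, _root_.pauliZ, Matrix.mul_apply] at h1
  · norm_num [_root_.pauliY, _root_.pauliZ, Matrix.mul_apply, self_eq_neg, neg_eq_self] at h1
  · exact Or.inr rfl

theorem IsPauliMatrix.eq_of_hasXPart_one {P : Matrix (Fin 2) (Fin 2) ℂ} (h : IsPauliMatrix P)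
    (h0 : HasXPart P 1) : P = _root_.pauliX ∨ P = _root_.pauliY := by
  have h1 := congrFun (congrFun h0 0) 0
  rcases h with rfl | rfl | rfl | rfl
  · norm_num [_root_.pauliZ, Matrix.mul_apply] at h1
  · exact Or.inl rfl
  · exact Or.inr rfl
  · norm_num [_root_.pauliZ, Matrix.mul_apply] at h1

/-- The `X` parts of the stabilizer. -/
def stabilizerXParts (ψ : QVec n) : Submodule (ZMod 2) (Fin n → ZMod 2) where
  carrier := {a | ∃ (ω : ℂ) (Q : Fin n → Matrix (Fin 2) (Fin 2) ℂ), ω ^ 4 = 1 ∧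
    (∀ j, Q j ∈ pauliGroupOne ∧ HasXPart (Q j) (a j)) ∧ (ω • tensorOp Q) *ᵥ ψ = ψ}
  zero_mem' := ⟨1, fun _ => 1, one_pow 4,
    fun _ => ⟨IsPauliMatrix.one.mem, by simp [HasXPart]⟩, by simp⟩
  add_mem' := by
    rintro a b ⟨ω, Q, hω, hQ, h⟩ ⟨ω', Q', hω', hQ', h'⟩
    refine ⟨ω * ω', fun j => Q j * Q' j, by rw [mul_pow, hω, hω', one_mul], fun j =>
      ⟨mul_mem_pauliGroupOne (hQ j).1 (hQ' j).1, (hQ j).2.mul (hQ' j).2⟩, ?_⟩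
    rw [← tensorOp_mul, ← smul_mul_smul_comm, ← Matrix.mulVec_mulVec, h', h]
  smul_mem' := by
    rintro c a ha
    rcases zmod_two_cases c with rfl | rfl
    · rw [zero_smul]
      exact ⟨1, fun _ => 1, one_pow 4,
        fun _ => ⟨IsPauliMatrix.one.mem, by simp [HasXPart]⟩, by simp⟩
    · rwa [one_smul]

/-- If no nontrivial product of `Z` operators stabilizes the state, then every `X` part occurs. -/
theorem IsStabilizerState.stabilizerXParts_eq_top {ψ : QVec n} (h : IsStabilizerState ψ)
    (hz : zLabels ψ ⊆ {∅}) : stabilizerXParts ψ = ⊤ := by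
  classical
  by_contra hne
  -- A proper subspace lies in the kernel of a nonzero functional `f`; its support is the candidate
  -- `S`.
  obtain ⟨f, hf, hker⟩ := Submodule.exists_le_ker_of_lt_top _ (lt_top_iff_ne_top.mpr hne)
  let S : Set (Fin n) := {j | f (Pi.single j 1) = 1}
  have hS : S ∈ zLabels ψ := by
    -- A stabilizer element with `X` part `a` commutes with `Z_S` up to the sign of `f a = 0`. Thus
    -- the stabilizer fixes `Z_S ψ`, which must be a multiple of `ψ`.
    refine h.2 _ ?_
    rintro A ⟨⟨ω, P, hω, hP, rfl⟩, hA⟩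
    choose a ha using fun j => IsPauliMatrix.exists_hasXPart (hP j)
    have hfa : f a = 0 := hker ⟨ω, P, hω, fun j => ⟨IsPauliMatrix.mem (hP j), ha j⟩, hA⟩
    have hsum : ∑ j, a j * f (Pi.single j 1) = 0 := by
      rw [← hfa, LinearMap.pi_apply_eq_sum_univ f a]
      simp only [smul_eq_mul]
      refine Finset.sum_congr rfl fun j _ => ?_
      congr 2
      ext1 l
      simp [Pi.single_apply, eq_comm]
    have hc : tensorOp P * zOn S = zOn S * tensorOp P := by
      rw [zOn, tensorOp_mul_eq_smul (ε := fun j => zmodSign (a j * f (Pi.single j 1))),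
        ← zmodSign_sum, hsum, zmodSign_zero, one_smul]
      intro j
      rcases zmod_two_cases (f (Pi.single j 1)) with hj | hj
      · have : j ∉ S := by simp [S, hj]
        simp [hj, this]
      · have : j ∈ S := hj
        rw [if_pos this, hj, mul_one]
        exact ha j
    rw [Matrix.mulVec_mulVec, smul_mul_assoc, hc, ← mul_smul_comm, ← Matrix.mulVec_mulVec, hA]
  have hS0 : S = ∅ := hz hS
  refine hf (LinearMap.pi_ext' fun j => LinearMap.ext_ring ?_)
  rcases zmod_two_cases (f (Pi.single j 1)) with hj | hj
  · simpa using hj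
  · have : j ∈ S := hj
    simp [hS0] at this

/-- This is a stabilizer element whose `X` part is the unit vector at `k`. -/
theorem IsStabilizerState.exists_generator {ψ : QVec n} (h : IsStabilizerState ψ)
    (hz : zLabels ψ ⊆ {∅}) (k : Fin n) :
    ∃ (ω : ℂ) (P : Fin n → Matrix (Fin 2) (Fin 2) ℂ), (ω = 1 ∨ ω = -1) ∧
      (P k = pauliX ∨ P k = pauliY) ∧ (∀ j, j ≠ k → P j = 1 ∨ P j = pauliZ) ∧
      (ω • tensorOp P) *ᵥ ψ = ψ := by
  have hk : Pi.single k 1 ∈ stabilizerXParts ψ := by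
    rw [h.stabilizerXParts_eq_top hz]; trivial
  obtain ⟨ω, Q, hω, hQ, hψ⟩ := hk
  choose z P hz4 hP hQP using fun j => (hQ j).1
  have hz0 : ∀ j, z j ≠ 0 := fun j h0 => by simpa [h0] using hz4 j
  obtain rfl : Q = fun j => z j • P j := funext hQP
  have hX : ∀ j, HasXPart (P j) ((Pi.single k 1 : Fin n → ZMod 2) j) := fun j => by
    have := (hQ j).2
    rw [HasXPart, smul_mul_assoc, mul_smul_comm, smul_comm] at this
    exact smul_right_injective _ (hz0 j) this
  rw [tensorOp_smul, smul_smul] at hψ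
  have hsq : tensorOp P * tensorOp P = 1 := by
    rw [tensorOp_mul]
    simp [fun j => IsPauliMatrix.mul_self (hP j)]
  refine ⟨ω * ∏ j, z j, P, ?_, ?_, fun j hj => ?_, hψ⟩
  -- The Pauli product squares to `1`, so fixing the nonzero `ψ` forces `w² = 1`.
  · set w := ω * ∏ j, z j
    have h1 : ((w • tensorOp P) * (w • tensorOp P)) *ᵥ ψ = ψ := by
      rw [← Matrix.mulVec_mulVec, hψ, hψ]
    rw [smul_mul_smul_comm, hsq, Matrix.smul_mulVec, Matrix.one_mulVec] at h1
    have h2 : (w * w - 1) • ψ = 0 := by rw [sub_smul, h1, one_smul, sub_self]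
    have h3 := (smul_eq_zero.mp h2).resolve_right h.1.ne_zero
    exact mul_self_eq_one_iff.mp (sub_eq_zero.mp h3)
  · have := hX k
    rw [Pi.single_eq_same] at this
    exact IsPauliMatrix.eq_of_hasXPart_one (hP k) this
  · have := hX j
    rw [Pi.single_eq_of_ne hj] at this
    exact IsPauliMatrix.eq_of_hasXPart_zero (hP j) this

theorem pauliZ_mul_of_xy {P : Matrix (Fin 2) (Fin 2) ℂ} (hP : P = pauliX ∨ P = pauliY) :
    pauliZ * P = (-1 : ℂ) • (P * pauliZ) := by
  rcases hP with rfl | rfl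
  · exact pauliZ_mul_pauliX
  · rw [pauliY_mul_pauliZ, pauliZ_mul_pauliY, smul_smul, neg_one_mul]

theorem pauliZ_ne_one : pauliZ ≠ 1 := by
  intro h
  have := congrFun (congrFun h 1) 1
  norm_num [pauliZ] at this

/-- A stabilizer state without nontrivial stabilizing products of `Z` operators is a graph state up
to local diagonal Clifford operators. -/
theorem IsStabilizerState.exists_graph_of_zLabels {ψ : QVec n} (h : IsStabilizerState ψ)
    (hz : zLabels ψ ⊆ {∅}) :
    ∃ (V : Fin n → Matrix (Fin 2) (Fin 2) ℂ) (G : SimpleGraph (Fin n)) (φ : QVec n),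
      IsLocalCliffordEquiv V G φ ψ := by
  classical
  choose ω P hω hXY h1Z hψ using h.exists_generator hz
  have hsq : ∀ k, tensorOp (P k) * tensorOp (P k) = 1 := fun k => by
    have : ∀ j, P k j * P k j = 1 := fun j => by
      refine IsPauliMatrix.mul_self ?_
      by_cases hj : j = k
      · subst hj
        rcases hXY j with h | h <;> rw [h]
        exacts [IsPauliMatrix.pauliX, IsPauliMatrix.pauliY]
      · rcases h1Z k j hj with h | h <;> rw [h]
        exacts [IsPauliMatrix.one, IsPauliMatrix.pauliZ]
    rw [tensorOp_mul]
    simp [this]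
  have heig : ∀ k, tensorOp (P k) *ᵥ ψ = ω k • ψ := fun k => by
    have h2 : ω k * ω k = 1 := mul_self_eq_one_iff.mpr (hω k)
    have h3 := congrArg (ω k • ·) (hψ k)
    simpa only [Matrix.smul_mulVec, smul_smul, h2, one_smul] using h3
  -- Were `P k j = 1`, the products `P j` and `P k` would anticommute at site `k` alone, although
  -- `ψ` is a common eigenvector.
  have hsymm : ∀ j k, j ≠ k → P j k = pauliZ → P k j = pauliZ := by
    intro j k hjk hZ
    refine (h1Z k j hjk).resolve_left fun h1 => h.1.ne_zero ?_
    refine eq_zero_of_anticommute (hsq j) (hsq k) ?_ (heig j) (heig k)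
    rw [tensorOp_mul_eq_smul (ε := fun l => if l = k then (-1 : ℂ) else 1)]
    · simp
    · intro l
      by_cases hlk : l = k
      · subst hlk
        rw [if_pos rfl, hZ]
        exact pauliZ_mul_of_xy (hXY l)
      · rw [if_neg hlk, one_smul]
        by_cases hlj : l = j
        · subst hlj
          rw [h1, mul_one, one_mul]
        · rcases h1Z j l hlj with h' | h' <;> rcases h1Z k l hlk with h'' | h'' <;> simp [h', h'']
  let G : SimpleGraph (Fin n) :=
    { Adj := fun j k => j ≠ k ∧ P j k = pauliZ
      symm := ⟨fun j k hjk => ⟨hjk.1.symm, hsymm j k hjk.1 hjk.2⟩⟩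
      loopless := ⟨fun j hj => hj.1 rfl⟩ }
  choose V hV hVX hVZ using fun k => exists_clifford_conj_pauliX (hXY k) (hω k)
  have hU := tensorOp_mem_unitary fun k => (hV k).1
  have h1 : (tensorOp V)ᴴ * tensorOp V = 1 := Matrix.mem_unitaryGroup_iff'.mp hU
  have h2 : tensorOp V * (tensorOp V)ᴴ = 1 := Matrix.mem_unitaryGroup_iff.mp hU
  -- `V k` fixes `Z` and takes `X` to `ω k • P k k`, so the whole sign is absorbed at site `k`.
  have hgen : ∀ k, tensorOp V * graphGen G k * (tensorOp V)ᴴ = ω k • tensorOp (P k) := fun k => by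
    have : ω k = ∏ j, if j = k then ω k else 1 := by simp
    rw [this, ← tensorOp_smul, graphGen_eq, tensorOp_conjTranspose, tensorOp_mul, tensorOp_mul]
    congr 1
    ext1 j
    unfold graphFactor
    by_cases hj : j = k
    · subst hj
      rw [if_pos rfl, if_pos rfl, hVX]
    · rw [if_neg hj, if_neg hj, one_smul]
      rcases h1Z k j hj with h' | h'
      · rw [if_neg fun ha => pauliZ_ne_one (ha.2.symm.trans h'), mul_one, h']
        exact Matrix.mem_unitaryGroup_iff.mp (hV j).1
      · rw [if_pos ⟨Ne.symm hj, h'⟩, h', hVZ]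
  refine ⟨V, G, (tensorOp V)ᴴ *ᵥ ψ, hV, ⟨?_, fun k => ?_⟩, ?_⟩
  · refine (dotProduct_mulVec_unitary ?_ ψ ψ).trans h.1
    rw [Matrix.conjTranspose_conjTranspose, h2]
  · have h3 := congrArg ((tensorOp V)ᴴ *ᵥ ·) (hψ k)
    rw [← hgen] at h3
    simpa only [Matrix.mulVec_mulVec, ← mul_assoc, h1, one_mul] using h3
  · rw [Matrix.mulVec_mulVec, h2, Matrix.one_mulVec]

/-- Every stabilizer state is local-Clifford equivalent to a graph state. -/
theorem IsStabilizerState.exists_localCliffordEquiv {ψ : QVec n} (h : IsStabilizerState ψ) :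
    ∃ (V : Fin n → Matrix (Fin 2) (Fin 2) ℂ) (G : SimpleGraph (Fin n)) (φ : QVec n),
      IsLocalCliffordEquiv V G φ ψ := by
  -- Each Hadamard at a site of a nonempty label lowers the finite number of labels; being
  -- involutions, the Hadamards can be moved into `V`.
  induction hN : (zLabels ψ).ncard using Nat.strong_induction_on generalizing ψ with
  | _ N ih =>
    by_cases hz : zLabels ψ ⊆ {∅}
    · exact h.exists_graph_of_zLabels hz
    · obtain ⟨S, hS, hne⟩ := Set.not_subset.mp hz
      obtain ⟨k, hk⟩ := Set.nonempty_iff_ne_empty.mpr hne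
      have hlt := Set.ncard_lt_ncard (zLabels_hadamard_ssubset h.1.ne_zero hS hk)
        (Set.toFinite _)
      let H : Fin n → Matrix (Fin 2) (Fin 2) ℂ := Function.update (fun _ => 1) k hadamard
      have hH : ∀ j, IsCliffordOne (H j) := fun j => by
        by_cases hj : j = k
        · subst hj; simpa [H] using isCliffordOne_hadamard
        · simpa [H, hj] using isCliffordOne_one
      obtain ⟨V, G, φ, hV, hφ, hVφ⟩ := ih _ (hN ▸ hlt) (h.tensorOp_mulVec hH) rfl
      refine ⟨fun j => H j * V j, G, φ, fun j => (hH j).mul (hV j), hφ, ?_⟩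
      have hHH : tensorOp H * tensorOp H = 1 := by
        change siteOp k hadamard * siteOp k hadamard = 1
        rw [siteOp_mul, hadamard_mul_self, siteOp_one]
      rw [← tensorOp_mul, ← Matrix.mulVec_mulVec, ← hVφ, Matrix.mulVec_mulVec, hHH,
        Matrix.one_mulVec]

end StandardForm

/-! ### Assembly of the theorem. -/

section MainTheorem

variable {n : ℕ}

/-- Unitary images of the graph state process have the same dissipative properties. -/
theorem IsGraphState.dissipation {V : QOp n} (hV : V ∈ Matrix.unitaryGroup (Bits n) ℂ)
    {G : SimpleGraph (Fin n)} {φ : QVec n} (h : IsGraphState G φ) {g : Fin n → ℝ}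
    (hg : ∀ k, 0 < g k) :
    IsUniqueStationaryState (liouvillian g fun k => V * graphJump G k * Vᴴ) (V *ᵥ φ) ∧
      NoPurelyImaginaryEigenvalue (liouvillian g fun k => V * graphJump G k * Vᴴ) ∧
      ∀ m : ℝ, IsLeast (Set.range g) m →
        IsRelaxationTime (liouvillian g fun k => V * graphJump G k * Vᴴ) (1 / m) := by
  -- The unitary is `V` after the graph basis change; it takes the label `0` to `V *ᵥ φ`.
  refine dissipation_of_unitary (mul_mem hV (graphBasisChange_mem_unitary h)) ?_ ?_ ?_ hg
  · exact (dotProduct_mulVec_unitary (Matrix.mem_unitaryGroup_iff'.mp hV) φ φ).trans h.1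
  · rw [← Matrix.mulVec_mulVec, graphBasisChange_mulVec_single, graphBasisVec_zero]
  · intro k
    rw [graphJump_eq h, Matrix.conjTranspose_mul]
    simp only [mul_assoc]

end MainTheorem

theorem mainTheorem5 (n : ℕ) :
    -- Graph states.
    (∀ G : SimpleGraph (Fin n),
      -- The graph state exists and is unique up to a phase.
      (∃ ψ : QVec n, IsGraphState G ψ) ∧
      (∀ ψ φ : QVec n, IsGraphState G ψ → IsGraphState G φ → ∃ z : ℂ, ‖z‖ = 1 ∧ φ = z • ψ) ∧
      -- `U_k` and `c_k` act non-trivially on the same qubits, namely on `k` and its neighbours,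
      -- and the `c_k` are quasi-local if the `U_k` are.
      (∀ (k : Fin n) (S : Finset (Fin n)),
        (ActsOnlyOn (graphGen G k) S ↔ insert k (G.neighborSet k) ⊆ (S : Set (Fin n))) ∧
        (ActsOnlyOn (graphJump G k) S ↔ insert k (G.neighborSet k) ⊆ (S : Set (Fin n)))) ∧
      (∀ (d : Fin n → Fin n → ℝ) (R : ℝ) (r : ℕ),
        IsQuasiLocal d R r (graphGen G) → IsQuasiLocal d R r (graphJump G)) ∧
      ∀ ψ : QVec n, IsGraphState G ψ →
        -- `c_k = U σ₋ U†`, where `U` takes the computational basis to the graph basis.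
        (∀ (k : Fin n) (i : Bits n),
          graphGen G k *ᵥ graphBasisVec ψ i = (-1 : ℂ) ^ (i k : ℕ) • graphBasisVec ψ i) ∧
        graphBasisChange ψ ∈ Matrix.unitaryGroup (Bits n) ℂ ∧
        (∀ k : Fin n, graphJump G k =
          graphBasisChange ψ * siteOp k sigmaMinus * (graphBasisChange ψ)ᴴ) ∧
        -- The process has `ψ` as its unique stationary state and relaxation time `1 / min g_k`.
        ∀ g : Fin n → ℝ, (∀ k, 0 < g k) →
          IsUniqueStationaryState (liouvillian g (graphJump G)) ψ ∧
          NoPurelyImaginaryEigenvalue (liouvillian g (graphJump G)) ∧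
          ∀ m : ℝ, IsLeast (Set.range g) m →
            IsRelaxationTime (liouvillian g (graphJump G)) (1 / m)) ∧
    -- Stabilizer states.
    (∀ ψ : QVec n, IsStabilizerState ψ →
      -- Every stabilizer state is local-Clifford equivalent to a graph state.
      (∃ (V : Fin n → Matrix (Fin 2) (Fin 2) ℂ) (G : SimpleGraph (Fin n)) (φ : QVec n),
        IsLocalCliffordEquiv V G φ ψ) ∧
      ∀ (V : Fin n → Matrix (Fin 2) (Fin 2) ℂ) (G : SimpleGraph (Fin n)) (φ : QVec n),
        IsLocalCliffordEquiv V G φ ψ →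
        -- `V U_k V†` lies in the stabilizer of `ψ` and acts non-trivially on the same qubits as
        -- `V c_k V†`, and the `V c_k V†` are quasi-local if the `U_k` are.
        (∀ k : Fin n, tensorOp V * graphGen G k * (tensorOp V)ᴴ ∈ pauliStabilizer ψ) ∧
        (∀ (k : Fin n) (S : Finset (Fin n)),
          (ActsOnlyOn (tensorOp V * graphGen G k * (tensorOp V)ᴴ) S ↔
            insert k (G.neighborSet k) ⊆ (S : Set (Fin n))) ∧
          (ActsOnlyOn (tensorOp V * graphJump G k * (tensorOp V)ᴴ) S ↔
            insert k (G.neighborSet k) ⊆ (S : Set (Fin n)))) ∧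
        (∀ (d : Fin n → Fin n → ℝ) (R : ℝ) (r : ℕ), IsQuasiLocal d R r (graphGen G) →
          IsQuasiLocal d R r fun k => tensorOp V * graphJump G k * (tensorOp V)ᴴ) ∧
        -- The process has `ψ` as its unique stationary state and relaxation time `1 / min g_k`.
        ∀ g : Fin n → ℝ, (∀ k, 0 < g k) →
          IsUniqueStationaryState
            (liouvillian g fun k => tensorOp V * graphJump G k * (tensorOp V)ᴴ) ψ ∧
          NoPurelyImaginaryEigenvalue
            (liouvillian g fun k => tensorOp V * graphJump G k * (tensorOp V)ᴴ) ∧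
          ∀ m : ℝ, IsLeast (Set.range g) m →
            IsRelaxationTime
              (liouvillian g fun k => tensorOp V * graphJump G k * (tensorOp V)ᴴ) (1 / m)) := by
  constructor
  · intro G
    refine ⟨exists_isGraphState G, fun ψ φ hψ hφ => hψ.eq_smul hφ, fun k S =>
      ⟨actsOnlyOn_graphGen_iff G k S, actsOnlyOn_graphJump_iff G k S⟩, fun d R r h =>
      h.of_actsOnlyOn fun k S => ?_, fun ψ hψ => ⟨graphGen_mulVec_graphBasisVec hψ.2,
      graphBasisChange_mem_unitary hψ, graphJump_eq hψ, fun g hg => ?_⟩⟩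
    · rw [actsOnlyOn_graphGen_iff, actsOnlyOn_graphJump_iff]
      exact id
    · simpa using hψ.dissipation (one_mem _) hg
  · intro ψ hψ
    refine ⟨hψ.exists_localCliffordEquiv, ?_⟩
    rintro V G φ ⟨hV, hφ, rfl⟩
    have hU : ∀ k, V k ∈ Matrix.unitaryGroup (Fin 2) ℂ := fun k => (hV k).1
    refine ⟨fun k => tensorOp_conj_mem_pauliStabilizer hV (graphGen_mem_pauliStabilizer hφ k),
      fun k S => ⟨?_, ?_⟩, fun d R r h => h.of_actsOnlyOn fun k S => ?_,
      fun g hg => hφ.dissipation (tensorOp_mem_unitary hU) hg⟩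
    · rw [actsOnlyOn_tensorOp_conj hU, actsOnlyOn_graphGen_iff]
    · rw [actsOnlyOn_tensorOp_conj hU, actsOnlyOn_graphJump_iff]
    · rw [actsOnlyOn_tensorOp_conj hU, actsOnlyOn_graphGen_iff, actsOnlyOn_graphJump_iff]
      exact id
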